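/- **Setting.** Let $(\Omega,\mathcal F,\mathbb P)$ be a probability space and let $(\tau_x)_{x\in\mathbb R}$ be a family of maps $\tau_x:\Omega\to\Omega$ such that $(x,\omega)\mapsto\tau_x\omega$ is jointly measurable, $\tau_0=\mathrm{id}$, $\tau_{x+y}=\tau_x\circ\tau_y$, each $\tau_x$ preserves $\mathbb P$, and the action is ergodic: every measurable $\varphi:\Omega\to\mathbb R$ such that, for each fixed $x\in\mathbb R$, $\varphi(\tau_x\omega)=\varphi(\omega)$ almost surely, is almost surely constant. A jointly measurable $f:\mathbb R\times\Omega\to\mathbb R$ is called *stationary* if $f(x,\omega)=f(0,\tau_x\omega)$ for all $(x,\omega)$. Let $a:\mathbb R\times\Omega\to(0,1]$ and $V:\mathbb R\times\Omega\to[0,1]$ be stationary, and assume that for some constant $\kappa>0$: * (A) $\sqrt{a(\cdot,\omega)}$ is $\kappa$-Lipschitz on $\mathbb R$ for every $\omega\in\Omega$; * (V) $V(\cdot,\omega)$ is $\kappa$-Lipschitz on $\mathbb R$ for every $\omega\in\Omega$; * (S) (scaled hill and valley condition) for every $h\in(0,1)$ and $y>0$, for almost every $\omega$ there are $\ell_1<\ell_2$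 with $\int_{\ell_1}^{\ell_2}\frac{dx}{a(x,\omega)}=y$ and $V(\cdot,\omega)\ge h$ on $[\ell_1,\ell_2]$; and likewise, for almost every $\omega$ there are $\ell_1<\ell_2$ with $\int_{\ell_1}^{\ell_2}\frac{dx}{a(x,\omega)}=y$ and $V(\cdot,\omega)\le h$ on $[\ell_1,\ell_2]$. Let $\beta>0$. **Classes of nonlinearities.** A function $G:\mathbb R\to\mathbb R$ is in $\mathscr G$ if there are constants $\alpha_0,\alpha_1>0$ and $\gamma>1$ such that, for all $p,q\in\mathbb R$, $$\alpha_0|p|^\gamma-\tfrac1{\alpha_0}\le G(p)\le\alpha_1(|p|^\gamma+1),\qquad |G(p)-G(q)|\le\alpha_1(|p|+|q|+1)^{\gamma-1}|p-q|.$$ A function $G\in\mathscr G$ is in $\mathscr G_0$ if $G(0)=0$, $G(p)>0$ for every $p\ne0$, and $G$ has only finitely many (points of) local extrema, at which it takes pairwise distinct values. A function $G\in\mathscr G$ is in $\mathscr G_1(a,V,\beta)$ if for every $\theta\in\mathbb R$ there is a unique constant $\lambda\ge\inf_{\mathbb R}G+\beta$ for which there exist stationary functions $\underline f,\overline f:\mathbb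 R\times\Omega\to\mathbb R$ (not necessarily distinct) such that 1. almost surely, $\underline f(\cdot,\omega)$ and $\overline f(\cdot,\omega)$ are bounded $C^1$ solutions on $\mathbb R$ of $$a(x,\omega)f'(x)+G(f(x))+\beta V(x,\omega)=\lambda;$$ 2. almost surely, $\inf_{x\in\mathbb R}\big(\overline f(x,\omega)-\underline f(x,\omega)\big)=0$; 3. $\underline f(0,\cdot)$ and $\overline f(0,\cdot)$ are integrable and $\mathbb E[\underline f(0,\omega)]\le\theta\le\mathbb E[\overline f(0,\omega)]$. **Theorem.** Under these assumptions, $\mathscr G_0\subset\mathscr G_1(a,V,\beta)$. -/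

import Mathlib

open MeasureTheory
open scoped NNReal

namespace ViscousHJ

/-- A measurable, measure preserving, ergodic action `(τ x)`, `x ∈ ℝ`, of the additive group of the
reals on the probability space `(Ω, P)`. Ergodicity: every real random variable that is almost
surely invariant under each `τ x` is almost surely constant. -/
structure IsErgodicFlow {Ω : Type*} [MeasurableSpace Ω] (P : Measure Ω) (τ : ℝ → Ω → Ω) :
    Prop where
  measurable_uncurry : Measurable (fun z : ℝ × Ω => τ z.1 z.2)
  zero : ∀ ω, τ 0 ω = ω
  add : ∀ x y ω, τ (x + y) ω = τ x (τ y ω)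
  measurePreserving : ∀ x, MeasurePreserving (τ x) P P
  ergodic : ∀ φ : Ω → ℝ, Measurable φ → (∀ x, ∀ᵐ ω ∂P, φ (τ x ω) = φ ω) →
    ∃ c : ℝ, ∀ᵐ ω ∂P, φ ω = c

/-- A (jointly measurable) random process that is stationary with respect to `τ`. -/
structure IsStationaryProcess {Ω : Type*} [MeasurableSpace Ω] (τ : ℝ → Ω → Ω)
    (f : ℝ → Ω → ℝ) : Prop where
  measurable_uncurry : Measurable (fun z : ℝ × Ω => f z.1 z.2)
  stationary : ∀ x ω, f x ω = f 0 (τ x ω)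

/-- The scaled hill condition. -/
def ScaledHill {Ω : Type*} [MeasurableSpace Ω] (P : Measure Ω) (a V : ℝ → Ω → ℝ) : Prop :=
  ∀ h : ℝ, 0 < h → h < 1 → ∀ y : ℝ, 0 < y → ∀ᵐ ω ∂P, ∃ l₁ l₂ : ℝ, l₁ < l₂ ∧
    (∫ x in l₁..l₂, 1 / a x ω) = y ∧ ∀ x ∈ Set.Icc l₁ l₂, h ≤ V x ω

/-- The scaled valley condition. -/
def ScaledValley {Ω : Type*} [MeasurableSpace Ω] (P : Measure Ω) (a V : ℝ → Ω → ℝ) : Prop :=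
  ∀ h : ℝ, 0 < h → h < 1 → ∀ y : ℝ, 0 < y → ∀ᵐ ω ∂P, ∃ l₁ l₂ : ℝ, l₁ < l₂ ∧
    (∫ x in l₁..l₂, 1 / a x ω) = y ∧ ∀ x ∈ Set.Icc l₁ l₂, V x ω ≤ h

/-- The class `𝒢` of nonlinearities: two-sided growth of order `γ > 1`, and a local Lipschitz
bound with constant growing like the power `γ - 1`. -/
def ClassG : Set (ℝ → ℝ) :=
  {G | ∃ α₀ α₁ γ : ℝ, 0 < α₀ ∧ 0 < α₁ ∧ 1 < γ ∧
    (∀ p, α₀ * |p| ^ γ - 1 / α₀ ≤ G p ∧ G p ≤ α₁ * (|p| ^ γ + 1)) ∧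
    (∀ p q, |G p - G q| ≤ α₁ * (|p| + |q| + 1) ^ (γ - 1) * |p - q|)}

/-- The class `𝒢₀`: strict global minimum `0` attained at `0`, finitely many local extrema, with
distinct values of `G` at distinct local extrema. -/
def ClassG0 : Set (ℝ → ℝ) :=
  {G | G ∈ ClassG ∧ G 0 = 0 ∧ (∀ p, p ≠ 0 → 0 < G p) ∧
    {p | IsLocalExtr G p}.Finite ∧ Set.InjOn G {p | IsLocalExtr G p}}

/-- `f` is a bounded `C¹` solution on `ℝ` of `a f' + G(f) + β V = lam` (for one realization of the
coefficients `a` and `V`). -/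
def IsBoundedC1Solution (G : ℝ → ℝ) (a V : ℝ → ℝ) (β lam : ℝ) (f : ℝ → ℝ) : Prop :=
  ContDiff ℝ 1 f ∧ (∃ C : ℝ, ∀ x, |f x| ≤ C) ∧
    ∀ x, a x * deriv f x + G (f x) + β * V x = lam

/-- The pair `(f₁, f₂)` of stationary processes has the properties required, at the slope `θ` and
the level `lam`, of the lower and the upper corrector. -/
structure IsCorrectorPair {Ω : Type*} [MeasurableSpace Ω] (P : Measure Ω) (τ : ℝ → Ω → Ω)
    (a V : ℝ → Ω → ℝ) (β : ℝ) (G : ℝ → ℝ) (θ lam : ℝ) (f₁ f₂ : ℝ → Ω → ℝ) : Prop where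
  stationary_lower : IsStationaryProcess τ f₁
  stationary_upper : IsStationaryProcess τ f₂
  solution_lower : ∀ᵐ ω ∂P,
    IsBoundedC1Solution G (fun x => a x ω) (fun x => V x ω) β lam (fun x => f₁ x ω)
  solution_upper : ∀ᵐ ω ∂P,
    IsBoundedC1Solution G (fun x => a x ω) (fun x => V x ω) β lam (fun x => f₂ x ω)
  inf_eq_zero : ∀ᵐ ω ∂P, IsGLB (Set.range fun x => f₂ x ω - f₁ x ω) 0
  integrable_lower : Integrable (fun ω => f₁ 0 ω) P
  integrable_upper : Integrable (fun ω => f₂ 0 ω) P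
  mean_lower : ∫ ω, f₁ 0 ω ∂P ≤ θ
  mean_upper : θ ≤ ∫ ω, f₂ 0 ω ∂P

/-- The class `𝒢₁(a, V, β)`: for every slope `θ` there is exactly one level
`lam ≥ inf G + β` at which a corrector pair exists. -/
def ClassG1 {Ω : Type*} [MeasurableSpace Ω] (P : Measure Ω) (τ : ℝ → Ω → Ω)
    (a V : ℝ → Ω → ℝ) (β : ℝ) : Set (ℝ → ℝ) :=
  {G | G ∈ ClassG ∧ ∀ θ : ℝ, ∃! lam : ℝ, sInf (Set.range G) + β ≤ lam ∧
    ∃ f₁ f₂ : ℝ → Ω → ℝ, IsCorrectorPair P τ a V β G θ lam f₁ f₂}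

end ViscousHJ

namespace ViscousHJ

open Filter Topology Set

/-! Uniqueness of the level. Comparison shows that along an orbit a subsolution that has fallen
below a supersolution stays below it, so by ergodicity stationary solutions are ordered along almost
every whole orbit (`order_of_sub_super`). Ordered solutions at different levels have a positive gap
(`IsStationarySolution.separation`). If two corrector pairs with the same slope had different
levels, the larger of the two lower correctors would be strictly separated from both members of the
other pair and would lie between them, contradicting the zero infimum of that pair's gap.

Existence. A stationary solution lies between any ordered stationary sub- and supersolution, in
either order (`IsMedium.exists_between` and its reflection). Constants are barriers: `p` is a
subsolution if `G p + β ≤ lam` and a supersolution if `lam ≤ G p`. Hence there are correctors with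
means on both sides of `θ`. Among the correctors of all levels at least `β = inf G + β`, choose `f₁`
with the largest mean not above `θ` and `f₂` with the smallest mean not below `θ`. No other such
corrector lies between them, so they share their level, as an intermediate level could otherwise be
solved between them.

It remains to see that `f₂ - f₁` has infimum zero (`IsAdjacent.ae_exists_sub_lt`). If not, averaging
over long hills and valleys shows that the range of each `fᵢ` contains a root of `G = lam - β` and a
root of `G = lam`. These roots are constant barriers, so they are the end points of the ranges. If
both ranges have the same orientation, the inner end points are a sub- and a supersolution with a
corrector between them, against adjacency. If the orientations are opposite, `G` has two local
extrema with the same value, against the definition of `ClassG0`. -/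

/-- Local Lipschitz continuity, in the form of one constant for each bounded interval. -/
def LipOnBounded (G : ℝ → ℝ) : Prop :=
  ∀ C : ℝ, ∃ L : ℝ, 0 < L ∧ ∀ p q, |p| ≤ C → |q| ≤ C → |G p - G q| ≤ L * |p - q|

lemma LipOnBounded.continuous {G : ℝ → ℝ} (hG : LipOnBounded G) : Continuous G := by
  rw [continuous_iff_continuousAt]
  intro p
  obtain ⟨L, hL, h⟩ := hG (|p| + 1)
  have hev : ∀ᶠ q in 𝓝 p, ‖G q - G p‖ ≤ L * |q - p| := by
    filter_upwards [Metric.ball_mem_nhds p one_pos] with q hq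
    rw [Metric.mem_ball, Real.dist_eq] at hq
    refine h q p ?_ (by linarith)
    have := abs_sub_abs_le_abs_sub q p
    linarith
  rw [ContinuousAt, tendsto_iff_norm_sub_tendsto_zero]
  refine squeeze_zero' (Eventually.of_forall fun _ => norm_nonneg _) hev ?_
  have : Tendsto (fun q => L * |q - p|) (𝓝 p) (𝓝 (L * |p - p|)) :=
    (by fun_prop : Continuous fun q => L * |q - p|).tendsto p
  simpa using this

lemma LipOnBounded.comp_neg {G : ℝ → ℝ} (hG : LipOnBounded G) :
    LipOnBounded fun p => G (-p) := by
  intro C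
  obtain ⟨L, hL, h⟩ := hG C
  refine ⟨L, hL, fun p q hp hq => ?_⟩
  have := h (-p) (-q) (by simpa using hp) (by simpa using hq)
  rwa [show -p - -q = -(p - q) by ring, abs_neg] at this

/-! ### Coefficients on the line and the intrinsic clock. -/

/-- Continuous coefficients `a ∈ (0, 1]` and `v ∈ [0, 1]` on the real line. -/
structure IsCoeff (a v : ℝ → ℝ) : Prop where
  cont_a : Continuous a
  pos : ∀ x, 0 < a x
  le_one : ∀ x, a x ≤ 1
  cont_v : Continuous v
  v_nonneg : ∀ x, 0 ≤ v x
  v_le_one : ∀ x, v x ≤ 1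

/-- The intrinsic time `∫₀ˣ 1 / a`. -/
noncomputable def clock (a : ℝ → ℝ) (x : ℝ) : ℝ := ∫ t in (0 : ℝ)..x, 1 / a t

section Coeff

variable {a v : ℝ → ℝ}

lemma IsCoeff.cont_inv (h : IsCoeff a v) : Continuous fun x => 1 / a x :=
  continuous_const.div h.cont_a fun x => (h.pos x).ne'

lemma IsCoeff.one_le_inv (h : IsCoeff a v) (x : ℝ) : 1 ≤ 1 / a x :=
  (one_le_div (h.pos x)).2 (h.le_one x)

lemma IsCoeff.hasDerivAt_clock (h : IsCoeff a v) (x : ℝ) :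
    HasDerivAt (clock a) (1 / a x) x :=
  h.cont_inv.integral_hasStrictDerivAt 0 x |>.hasDerivAt

lemma IsCoeff.clock_sub_le (h : IsCoeff a v) {x y : ℝ} (hxy : x ≤ y) :
    y - x ≤ clock a y - clock a x := by
  have hm : Monotone fun x => clock a x - x :=
    monotone_of_hasDerivAt_nonneg (fun x => (h.hasDerivAt_clock x).sub (hasDerivAt_id x))
      (fun x => sub_nonneg.2 (h.one_le_inv x))
  have := hm hxy
  simp only at this
  linarith

lemma clock_zero : clock a 0 = 0 := by simp [clock]

lemma IsCoeff.tendsto_clock_atBot (h : IsCoeff a v) : Tendsto (clock a) atBot atBot := by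
  refine tendsto_atBot_mono' atBot ?_ tendsto_id
  filter_upwards [eventually_le_atBot 0] with x hx
  have := h.clock_sub_le hx
  simp only [clock_zero] at this
  simp only [id]
  linarith

lemma IsCoeff.clock_eq_integral (h : IsCoeff a v) (x y : ℝ) :
    ∫ t in x..y, 1 / a t = clock a y - clock a x := by
  unfold clock
  rw [intervalIntegral.integral_interval_sub_left] <;>
    exact h.cont_inv.intervalIntegrable _ _

lemma IsCoeff.tendsto_exp_clock_atBot (h : IsCoeff a v) {L : ℝ} (hL : 0 < L) :
    Tendsto (fun x => Real.exp (L * clock a x)) atBot (𝓝 0) :=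
  Real.tendsto_exp_atBot.comp (h.tendsto_clock_atBot.const_mul_atBot hL)

lemma IsCoeff.hasDerivAt_exp_clock (h : IsCoeff a v) (L x : ℝ) :
    HasDerivAt (fun x => Real.exp (L * clock a x)) (L * (Real.exp (L * clock a x) / a x)) x := by
  convert ((h.hasDerivAt_clock x).const_mul L).exp using 1
  ring

/-- The bound forces the limit at `-∞` to be zero, and a monotone function lies above that limit.
For bounded entire functions this takes the place of an initial condition. -/
lemma IsCoeff.nonneg_of_monotone (h : IsCoeff a v) {L C : ℝ} (hL : 0 < L) {D : ℝ → ℝ}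
    (hD : Monotone D) (hb : ∀ x, |D x| ≤ C * Real.exp (L * clock a x)) (x : ℝ) : 0 ≤ D x := by
  have h0 : Tendsto D atBot (𝓝 0) := by
    refine squeeze_zero_norm hb ?_
    simpa using (h.tendsto_exp_clock_atBot hL).const_mul C
  exact le_of_tendsto h0 (by filter_upwards [eventually_le_atBot x] with y hy using hD hy)

/-- The reflected coefficients. -/
lemma IsCoeff.reflect (h : IsCoeff a v) : IsCoeff (fun x => a (-x)) (fun x => v (-x)) where
  cont_a := h.cont_a.comp continuous_neg
  pos _ := h.pos _
  le_one _ := h.le_one _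
  cont_v := h.cont_v.comp continuous_neg
  v_nonneg _ := h.v_nonneg _
  v_le_one _ := h.v_le_one _

end Coeff

/-! ### Sub- and supersolutions of the deterministic equation. -/

/-- Differentiable subsolutions of `a f' + G(f) + β v = lam`. -/
def IsSub (G : ℝ → ℝ) (a v : ℝ → ℝ) (β lam : ℝ) (f : ℝ → ℝ) : Prop :=
  Differentiable ℝ f ∧ ∀ x, a x * deriv f x + G (f x) + β * v x ≤ lam

/-- Differentiable supersolutions of `a f' + G(f) + β v = lam`. -/
def IsSuper (G : ℝ → ℝ) (a v : ℝ → ℝ) (β lam : ℝ) (f : ℝ → ℝ) : Prop :=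
  Differentiable ℝ f ∧ ∀ x, lam ≤ a x * deriv f x + G (f x) + β * v x

section ODE

variable {G a v : ℝ → ℝ} {β lam lam₁ lam₂ C : ℝ} {f g : ℝ → ℝ}

lemma IsBoundedC1Solution.isSub (h : IsBoundedC1Solution G a v β lam₁ f) (hl : lam₁ ≤ lam₂) :
    IsSub G a v β lam₂ f :=
  ⟨h.1.differentiable one_ne_zero, fun x => (h.2.2 x).trans_le hl⟩

lemma IsBoundedC1Solution.isSuper (h : IsBoundedC1Solution G a v β lam₁ f) (hl : lam₂ ≤ lam₁) :
    IsSuper G a v β lam₂ f :=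
  ⟨h.1.differentiable one_ne_zero, fun x => hl.trans_eq (h.2.2 x).symm⟩

lemma IsCoeff.isSub_const (h : IsCoeff a v) (hβ : 0 < β) {p : ℝ} (hp : G p + β ≤ lam) :
    IsSub G a v β lam fun _ => p := by
  refine ⟨differentiable_const p, fun x => ?_⟩
  have := mul_le_mul_of_nonneg_left (h.v_le_one x) hβ.le
  simp only [deriv_const, mul_zero]
  linarith

lemma IsCoeff.isSuper_const (h : IsCoeff a v) (hβ : 0 < β) {p : ℝ} (hp : lam ≤ G p) :
    IsSuper G a v β lam fun _ => p := by
  refine ⟨differentiable_const p, fun x => ?_⟩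
  have := mul_nonneg hβ.le (h.v_nonneg x)
  simp only [deriv_const, mul_zero]
  linarith

/-- The map `f ↦ -f (-·)` leaves the sign of the derivative unchanged, so it keeps subsolutions and
supersolutions while reversing their order. Results for "sub below super" thus transfer to "super
below sub". -/
lemma IsSub.reflect (hf : IsSub G a v β lam f) :
    IsSub (fun p => G (-p)) (fun x => a (-x)) (fun x => v (-x)) β lam fun x => -f (-x) := by
  refine ⟨(hf.1.comp differentiable_neg).neg, fun x => ?_⟩
  have : deriv (fun x => -f (-x)) x = deriv f (-x) := by
    rw [deriv.fun_neg, deriv_comp_neg, neg_neg]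
  simpa [this] using hf.2 (-x)

lemma IsSuper.reflect (hf : IsSuper G a v β lam f) :
    IsSuper (fun p => G (-p)) (fun x => a (-x)) (fun x => v (-x)) β lam fun x => -f (-x) := by
  refine ⟨(hf.1.comp differentiable_neg).neg, fun x => ?_⟩
  have : deriv (fun x => -f (-x)) x = deriv f (-x) := by
    rw [deriv.fun_neg, deriv_comp_neg, neg_neg]
  simpa [this] using hf.2 (-x)

lemma IsBoundedC1Solution.reflect (hf : IsBoundedC1Solution G a v β lam f) :
    IsBoundedC1Solution (fun p => G (-p)) (fun x => a (-x)) (fun x => v (-x)) β lam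
      fun x => -f (-x) := by
  refine ⟨(hf.1.comp contDiff_neg).neg, ?_, fun x => ?_⟩
  · obtain ⟨C, hC⟩ := hf.2.1
    exact ⟨C, fun x => by simpa using hC (-x)⟩
  have : deriv (fun x => -f (-x)) x = deriv f (-x) := by
    rw [deriv.fun_neg, deriv_comp_neg, neg_neg]
  simpa [this] using hf.2.2 (-x)

/-- Comparison: a subsolution that starts below a supersolution stays below it. -/
lemma IsCoeff.comparison (h : IsCoeff a v) (hG : LipOnBounded G)
    (hf : IsSub G a v β lam f) (hg : IsSuper G a v β lam g)
    (hfC : ∀ x, |f x| ≤ C) (hgC : ∀ x, |g x| ≤ C) {x₀ x : ℝ} (h0 : f x₀ ≤ g x₀)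
    (hx : x₀ ≤ x) : f x ≤ g x := by
  obtain ⟨L, hL, hLip⟩ := hG C
  by_contra! hlt
  -- the last zero of `f - g` before `x`
  set Z := {y | y ∈ Icc x₀ x ∧ f y - g y ≤ 0} with hZ
  have hcont : Continuous fun y => f y - g y := hf.1.continuous.sub hg.1.continuous
  have hZc : IsCompact Z :=
    (isCompact_Icc).inter_right (isClosed_le hcont continuous_const)
  obtain ⟨z, hzZ, hzmax⟩ := hZc.exists_isGreatest ⟨x₀, ⟨le_rfl, hx⟩, by linarith⟩
  have hzx : z ≤ x := hzZ.1.2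
  have hpos : ∀ y ∈ Ioc z x, 0 < f y - g y := fun y hy => by
    by_contra! hn
    exact absurd (hzmax ⟨⟨hzZ.1.1.trans hy.1.le, hy.2⟩, hn⟩) (not_le.2 hy.1)
  -- Where `f > g`, one has `a (f - g)' ≤ L (f - g)`; the factor `exp (-L * clock)` makes the
  -- weighted difference nonincreasing after its last zero.
  set E : ℝ → ℝ := fun y => Real.exp ((-L) * clock a y) * (f y - g y) with hE
  have hder : ∀ y, HasDerivAt E ((-L) * (Real.exp ((-L) * clock a y) / a y) * (f y - g y)
      + Real.exp ((-L) * clock a y) * (deriv f y - deriv g y)) y := fun y =>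
    (h.hasDerivAt_exp_clock (-L) y).mul ((hf.1 y).hasDerivAt.sub (hg.1 y).hasDerivAt)
  have hanti : AntitoneOn E (Icc z x) := by
    refine antitoneOn_of_hasDerivWithinAt_nonpos (convex_Icc z x)
      (fun y _ => (hder y).continuousAt.continuousWithinAt)
      (fun y _ => (hder y).hasDerivWithinAt) fun y hy => ?_
    rw [interior_Icc] at hy
    have hw := hpos y ⟨hy.1, hy.2.le⟩
    have h1 := hf.2 y
    have h2 := hg.2 y
    have h3 := hLip (f y) (g y) (hfC y) (hgC y)
    rw [abs_of_pos hw] at h3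
    have h4 := (abs_le.1 h3).1
    have ha := h.pos y
    have hk : a y * (deriv f y - deriv g y) ≤ L * (f y - g y) := by nlinarith
    have hk' : deriv f y - deriv g y ≤ L * (f y - g y) / a y := by
      rw [le_div_iff₀ ha]; linarith
    have he := Real.exp_pos ((-L) * clock a y)
    calc _ = Real.exp ((-L) * clock a y) * ((deriv f y - deriv g y) - L * (f y - g y) / a y) := by
          ring
      _ ≤ 0 := mul_nonpos_of_nonneg_of_nonpos he.le (by linarith)
  have h1 := hanti (left_mem_Icc.2 hzx) (right_mem_Icc.2 hzx) hzx
  have h2 : E z ≤ 0 := mul_nonpos_of_nonneg_of_nonpos (Real.exp_pos _).le hzZ.2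
  have h3 : 0 < E x := mul_pos (Real.exp_pos _) (by linarith)
  linarith

/-- Ordered solutions at different levels are uniformly separated. -/
lemma IsCoeff.separation_of_le (h : IsCoeff a v) (hG : LipOnBounded G) (hl : lam₁ < lam₂)
    (hf : IsBoundedC1Solution G a v β lam₁ f) (hg : IsBoundedC1Solution G a v β lam₂ g)
    (hle : ∀ x, f x ≤ g x) : ∃ ε > 0, ∀ x, f x + ε ≤ g x := by
  obtain ⟨C₁, hC₁⟩ := hf.2.1
  obtain ⟨C₂, hC₂⟩ := hg.2.1
  obtain ⟨L, hL, hLip⟩ := hG (max C₁ C₂)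
  have hδ : 0 < (lam₂ - lam₁) / L := div_pos (by linarith) hL
  refine ⟨(lam₂ - lam₁) / L, hδ, fun x => ?_⟩
  -- Since `f ≤ g`, the difference `w = g - f` satisfies `a w' + L w ≥ lam₂ - lam₁`, whose
  -- equilibrium is `(lam₂ - lam₁) / L`. Its weighted excess over this value is monotone and
  -- vanishes at `-∞`.
  set D : ℝ → ℝ := fun y => Real.exp (L * clock a y) * (g y - f y - (lam₂ - lam₁) / L) with hD
  have hdf := hf.1.differentiable one_ne_zero
  have hdg := hg.1.differentiable one_ne_zero
  have hmono : Monotone D := by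
    refine monotone_of_hasDerivAt_nonneg (fun y => (h.hasDerivAt_exp_clock L y).mul
      (((hdg y).hasDerivAt.sub (hdf y).hasDerivAt).sub_const _)) fun y => ?_
    have h1 := hf.2.2 y
    have h2 := hg.2.2 y
    have h3 := hLip (g y) (f y) ((hC₂ y).trans (le_max_right _ _))
      ((hC₁ y).trans (le_max_left _ _))
    rw [abs_of_nonneg (sub_nonneg.2 (hle y))] at h3
    have h4 := (abs_le.1 h3).2
    have ha := h.pos y
    have hk : (lam₂ - lam₁) - L * (g y - f y) ≤ (deriv g y - deriv f y) * a y := by nlinarith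
    rw [← div_le_iff₀ ha] at hk
    have he := Real.exp_pos (L * clock a y)
    calc (0:ℝ) ≤ Real.exp (L * clock a y) * ((deriv g y - deriv f y)
          - ((lam₂ - lam₁) - L * (g y - f y)) / a y) := mul_nonneg he.le (by linarith)
      _ = _ := by
        field_simp
        ring
  have := h.nonneg_of_monotone (C := C₂ + C₁ + (lam₂ - lam₁) / L) hL hmono (fun y => by
    rw [hD, abs_mul, abs_of_pos (Real.exp_pos _), mul_comm]
    refine mul_le_mul_of_nonneg_right ?_ (Real.exp_pos _).le
    have h1 := abs_le.1 (hC₁ y)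
    have h2 := abs_le.1 (hC₂ y)
    rw [abs_le]
    constructor <;> linarith) x
  have := (mul_nonneg_iff_of_pos_left (Real.exp_pos _)).1 this
  linarith

lemma IsCoeff.separation_of_ge (h : IsCoeff a v) (hG : LipOnBounded G) (hl : lam₁ < lam₂)
    (hf : IsBoundedC1Solution G a v β lam₁ f) (hg : IsBoundedC1Solution G a v β lam₂ g)
    (hle : ∀ x, g x ≤ f x) : ∃ ε > 0, ∀ x, g x + ε ≤ f x := by
  obtain ⟨ε, hε, H⟩ := h.reflect.separation_of_le hG.comp_neg hl hf.reflect hg.reflect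
    fun x => neg_le_neg (hle (-x))
  refine ⟨ε, hε, fun x => ?_⟩
  have := H (-x)
  rw [neg_neg] at this
  linarith

/-- A bounded solution forces a bound on its level. -/
lemma IsCoeff.level_le (h : IsCoeff a v) (hβ : 0 < β) {M : ℝ}
    (hf : IsBoundedC1Solution G a v β lam f) (hM : ∀ x, G (f x) ≤ M) : lam ≤ M + β + 1 := by
  by_contra! hlt
  obtain ⟨C, hC⟩ := hf.2.1
  -- A higher level would give `a f' ≥ 1`, hence `f' ≥ 1` because `a ≤ 1`, and `f` would grow by
  -- more than `2 * C` on an interval of length `2 * C + 1`.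
  have hm : Monotone fun x => f x - x :=
    monotone_of_hasDerivAt_nonneg
      (fun x => ((hf.1.differentiable one_ne_zero x).hasDerivAt).sub (hasDerivAt_id x))
      (fun x => by
        have h1 := hf.2.2 x
        have h2 := mul_le_mul_of_nonneg_left (h.v_le_one x) hβ.le
        have h3 := hM x
        have ha := h.pos x
        have ha1 := h.le_one x
        have : 1 ≤ a x * deriv f x := by linarith
        simp only [Pi.zero_apply]
        nlinarith)
  have h1 := hm (show (0:ℝ) ≤ 2 * C + 1 by have := (abs_nonneg _).trans (hC 0); linarith)
  have h2 := abs_le.1 (hC 0)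
  have h3 := abs_le.1 (hC (2 * C + 1))
  simp only at h1
  linarith

end ODE

/-! ### The linear integral operator whose fixed points are the bounded solutions. -/

/-- The density `exp (L S) / a`, where `S` is the clock. -/
noncomputable def expWeight (a : ℝ → ℝ) (L s : ℝ) : ℝ := Real.exp (L * clock a s) / a s

/-- The inhomogeneity of `a f' + L f = lam - β v - G(φ) + L φ`. -/
def source (G v : ℝ → ℝ) (β lam L : ℝ) (φ : ℝ → ℝ) (s : ℝ) : ℝ :=
  lam - β * v s - G (φ s) + L * φ s

/-- The bounded entire solution `f` of `a f' + L f = lam - β v - G(φ) + L φ`. -/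
noncomputable def linearSolution (G a v : ℝ → ℝ) (β lam L : ℝ) (φ : ℝ → ℝ) (x : ℝ) : ℝ :=
  Real.exp (-(L * clock a x)) * ∫ s in Iic x, expWeight a L s * source G v β lam L φ s

section

variable {G a v : ℝ → ℝ} {β lam L C : ℝ} {φ ψ : ℝ → ℝ}

lemma IsCoeff.continuous_clock (h : IsCoeff a v) : Continuous (clock a) :=
  continuous_iff_continuousAt.2 fun x => (h.hasDerivAt_clock x).continuousAt

lemma IsCoeff.expWeight_pos (h : IsCoeff a v) (s : ℝ) : 0 < expWeight a L s :=
  div_pos (Real.exp_pos _) (h.pos s)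

lemma IsCoeff.continuous_expWeight (h : IsCoeff a v) : Continuous (expWeight a L) :=
  (Real.continuous_exp.comp (continuous_const.mul h.continuous_clock)).div h.cont_a
    fun x => (h.pos x).ne'

lemma IsCoeff.hasDerivAt_exp_div (h : IsCoeff a v) (hL : 0 < L) (x : ℝ) :
    HasDerivAt (fun x => Real.exp (L * clock a x) / L) (expWeight a L x) x := by
  have := (h.hasDerivAt_exp_clock L x).div_const L
  rwa [mul_div_cancel_left₀ _ hL.ne'] at this

lemma IsCoeff.integrableOn_expWeight (h : IsCoeff a v) (hL : 0 < L) (x : ℝ) :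
    IntegrableOn (expWeight a L) (Iic x) := by
  refine integrableOn_Iic_of_intervalIntegral_norm_bounded (l := atBot) (a := id)
    (Real.exp (L * clock a x) / L) x
    (fun i => (h.continuous_expWeight.integrableOn_Icc).mono_set Ioc_subset_Icc_self) tendsto_id
    (Eventually.of_forall fun i => ?_)
  have : ∀ s, ‖expWeight a L s‖ = expWeight a L s := fun s =>
    Real.norm_of_nonneg (h.expWeight_pos s).le
  simp only [this, id]
  rw [intervalIntegral.integral_eq_sub_of_hasDerivAt (fun y _ => h.hasDerivAt_exp_div hL y)
    (h.continuous_expWeight.intervalIntegrable _ _)]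
  have := div_pos (Real.exp_pos (L * clock a i)) hL
  linarith

lemma IsCoeff.integral_expWeight (h : IsCoeff a v) (hL : 0 < L) (x : ℝ) :
    ∫ s in Iic x, expWeight a L s = Real.exp (L * clock a x) / L := by
  rw [integral_Iic_of_hasDerivAt_of_tendsto' (m := 0) (fun y _ => h.hasDerivAt_exp_div hL y)
    (h.integrableOn_expWeight hL x), sub_zero]
  simpa using (h.tendsto_exp_clock_atBot hL).div_const L

lemma LipOnBounded.exists_bound (hG : LipOnBounded G) (C : ℝ) :
    ∃ M, ∀ p, |p| ≤ C → |G p| ≤ M := by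
  obtain ⟨M, hM⟩ := (isCompact_Icc (a := -C) (b := C)).exists_bound_of_continuousOn
    hG.continuous.continuousOn
  exact ⟨M, fun p hp => hM p (abs_le.1 hp)⟩

lemma IsCoeff.exists_source_bound (h : IsCoeff a v) (hG : LipOnBounded G) (hβ : 0 < β)
    (hL : 0 < L) : ∃ M, ∀ φ : ℝ → ℝ, ∀ s, |φ s| ≤ C → |source G v β lam L φ s| ≤ M := by
  obtain ⟨M, hM⟩ := hG.exists_bound C
  refine ⟨|lam| + β + M + L * C, fun φ s hs => ?_⟩
  have h1 := hM _ hs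
  have h2 : |β * v s| ≤ β := by
    rw [abs_of_nonneg (mul_nonneg hβ.le (h.v_nonneg s))]
    exact mul_le_of_le_one_right hβ.le (h.v_le_one s)
  have h3 : |L * φ s| ≤ L * C := by
    rw [abs_mul, abs_of_pos hL]
    exact mul_le_mul_of_nonneg_left hs hL.le
  unfold source
  calc _ ≤ |lam - β * v s - G (φ s)| + |L * φ s| := abs_add_le _ _
    _ ≤ |lam| + |β * v s| + |G (φ s)| + |L * φ s| := by
      gcongr
      refine (abs_sub _ _).trans ?_
      gcongr
      exact abs_sub _ _
    _ ≤ _ := by gcongr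

lemma IsCoeff.measurable_source (h : IsCoeff a v) (hG : LipOnBounded G) (hφ : Measurable φ) :
    Measurable (source G v β lam L φ) :=
  ((measurable_const.sub (h.cont_v.measurable.const_mul β)).sub
    (hG.continuous.measurable.comp hφ)).add (hφ.const_mul L)

lemma IsCoeff.integrableOn_weighted_source (h : IsCoeff a v) (hG : LipOnBounded G) (hβ : 0 < β)
    (hL : 0 < L) (hφ : Measurable φ) (hC : ∀ s, |φ s| ≤ C) (x : ℝ) :
    IntegrableOn (fun s => expWeight a L s * source G v β lam L φ s) (Iic x) := by
  obtain ⟨M, hM⟩ := h.exists_source_bound (lam := lam) (C := C) hG hβ hL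
  exact (h.integrableOn_expWeight hL x).mul_bdd (c := M)
    (h.measurable_source hG hφ).aestronglyMeasurable (ae_of_all _ fun s => hM φ s (hC s))

/-- The kernel is positive, and `p ↦ L * p - G p` is nondecreasing on `[-C, C]` because `L` is a
Lipschitz constant of `G` there. -/
lemma IsCoeff.linearSolution_mono (h : IsCoeff a v) (hG : LipOnBounded G) (hβ : 0 < β)
    (hL : 0 < L) (hLip : ∀ p q, |p| ≤ C → |q| ≤ C → |G p - G q| ≤ L * |p - q|)
    (hφ : Measurable φ) (hφC : ∀ s, |φ s| ≤ C) (hψ : Measurable ψ) (hψC : ∀ s, |ψ s| ≤ C)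
    (hle : ∀ s, φ s ≤ ψ s) (x : ℝ) :
    linearSolution G a v β lam L φ x ≤ linearSolution G a v β lam L ψ x := by
  refine mul_le_mul_of_nonneg_left ?_ (Real.exp_pos _).le
  refine setIntegral_mono (h.integrableOn_weighted_source hG hβ hL hφ hφC x)
    (h.integrableOn_weighted_source hG hβ hL hψ hψC x) fun s => ?_
  refine mul_le_mul_of_nonneg_left ?_ (h.expWeight_pos s).le
  have h1 := hLip (ψ s) (φ s) (hψC s) (hφC s)
  rw [abs_of_nonneg (sub_nonneg.2 (hle s))] at h1
  have h2 := (abs_le.1 h1).2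
  unfold source
  linarith

lemma hasDerivAt_integral_Iic {F : ℝ → ℝ} (hF : Continuous F)
    (hint : ∀ x, IntegrableOn F (Iic x)) (x : ℝ) :
    HasDerivAt (fun x => ∫ s in Iic x, F s) (F x) x := by
  have h1 : (fun x => ∫ s in Iic x, F s) =
      fun x => (∫ s in Iic (0:ℝ), F s) + ∫ s in (0:ℝ)..x, F s := by
    funext y
    rw [← intervalIntegral.integral_Iic_sub_Iic (hint 0) (hint y)]
    ring
  rw [h1]
  exact (hF.integral_hasStrictDerivAt 0 x).hasDerivAt.const_add _

/-- No continuity of `F` is assumed: this starts the regularity bootstrap for fixed points that are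
only known to be measurable. -/
lemma continuous_integral_Iic {F : ℝ → ℝ}
    (hint : ∀ x, IntegrableOn F (Iic x)) : Continuous fun x => ∫ s in Iic x, F s := by
  have h1 : (fun x => ∫ s in Iic x, F s) =
      fun x => (∫ s in Iic (0:ℝ), F s) + ∫ s in (0:ℝ)..x, F s := by
    funext y
    rw [← intervalIntegral.integral_Iic_sub_Iic (hint 0) (hint y)]
    ring
  rw [h1]
  refine continuous_const.add (intervalIntegral.continuous_primitive (fun b c => ?_) 0)
  rw [intervalIntegrable_iff]
  exact (hint (max b c)).mono_set fun y hy => (mem_uIoc.1 hy).elim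
    (fun H => H.2.trans (le_max_right _ _)) fun H => H.2.trans (le_max_left _ _)

lemma IsCoeff.abs_integral_source_le (h : IsCoeff a v) (hG : LipOnBounded G) (hβ : 0 < β)
    (hL : 0 < L) (hC : ∀ s, |φ s| ≤ C) : ∃ M, ∀ x,
    |∫ s in Iic x, expWeight a L s * source G v β lam L φ s| ≤ M * Real.exp (L * clock a x) := by
  obtain ⟨M, hM⟩ := h.exists_source_bound (lam := lam) (C := C) hG hβ hL
  refine ⟨M / L, fun x => ?_⟩
  calc _ ≤ ∫ s in Iic x, M * expWeight a L s := by
        rw [← Real.norm_eq_abs]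
        refine norm_integral_le_of_norm_le ((h.integrableOn_expWeight hL x).const_mul M)
          (ae_of_all _ fun s => ?_)
        rw [norm_mul, Real.norm_of_nonneg (h.expWeight_pos s).le, mul_comm]
        exact mul_le_mul_of_nonneg_right (hM φ s (hC s)) (h.expWeight_pos s).le
    _ = _ := by
      rw [integral_const_mul, h.integral_expWeight hL]
      ring

/-- With the integrating factor `exp (L * clock)`, the subsolution inequality says that the weighted
difference of the two sides is nondecreasing; it vanishes at `-∞`. -/
lemma IsCoeff.le_linearSolution (h : IsCoeff a v) (hG : LipOnBounded G) (hβ : 0 < β)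
    (hL : 0 < L) (hφ : IsSub G a v β lam φ) (hC : ∀ s, |φ s| ≤ C) (x : ℝ) :
    φ x ≤ linearSolution G a v β lam L φ x := by
  have hm := hφ.1.continuous.measurable
  have hcont : Continuous fun s => expWeight a L s * source G v β lam L φ s := by
    unfold source
    exact h.continuous_expWeight.mul (((continuous_const.sub (continuous_const.mul h.cont_v)).sub
      (hG.continuous.comp hφ.1.continuous)).add (continuous_const.mul hφ.1.continuous))
  obtain ⟨M, hM⟩ := h.abs_integral_source_le (lam := lam) hG hβ hL hC
  have hmono : Monotone fun x => (∫ s in Iic x, expWeight a L s * source G v β lam L φ s)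
      - Real.exp (L * clock a x) * φ x := by
    refine monotone_of_hasDerivAt_nonneg (fun y => (hasDerivAt_integral_Iic hcont
      (h.integrableOn_weighted_source hG hβ hL hm hC) y).sub
      ((h.hasDerivAt_exp_clock L y).mul (hφ.1 y).hasDerivAt)) fun y => ?_
    have ha := h.pos y
    have h1 := hφ.2 y
    have : 0 ≤ expWeight a L y * (source G v β lam L φ y - (a y * deriv φ y + L * φ y)) :=
      mul_nonneg (h.expWeight_pos y).le (by unfold source; linarith)
    refine this.trans_eq ?_
    unfold expWeight
    field_simp
    ring
  have := h.nonneg_of_monotone (C := M + C) hL hmono (fun y => by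
    refine (abs_sub _ _).trans ?_
    rw [abs_mul, abs_of_pos (Real.exp_pos _), add_mul, mul_comm C]
    exact add_le_add (hM y) (mul_le_mul_of_nonneg_left (hC y) (Real.exp_pos _).le)) x
  unfold linearSolution
  rw [Real.exp_neg, ← div_eq_inv_mul, le_div_iff₀ (Real.exp_pos _)]
  linarith

lemma IsCoeff.linearSolution_le (h : IsCoeff a v) (hG : LipOnBounded G) (hβ : 0 < β)
    (hL : 0 < L) (hφ : IsSuper G a v β lam φ) (hC : ∀ s, |φ s| ≤ C) (x : ℝ) :
    linearSolution G a v β lam L φ x ≤ φ x := by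
  have hm := hφ.1.continuous.measurable
  have hcont : Continuous fun s => expWeight a L s * source G v β lam L φ s := by
    unfold source
    exact h.continuous_expWeight.mul (((continuous_const.sub (continuous_const.mul h.cont_v)).sub
      (hG.continuous.comp hφ.1.continuous)).add (continuous_const.mul hφ.1.continuous))
  obtain ⟨M, hM⟩ := h.abs_integral_source_le (lam := lam) hG hβ hL hC
  have hmono : Monotone fun x => Real.exp (L * clock a x) * φ x -
      ∫ s in Iic x, expWeight a L s * source G v β lam L φ s := by
    refine monotone_of_hasDerivAt_nonneg (fun y =>
      ((h.hasDerivAt_exp_clock L y).mul (hφ.1 y).hasDerivAt).sub (hasDerivAt_integral_Iic hcont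
      (h.integrableOn_weighted_source hG hβ hL hm hC) y)) fun y => ?_
    have ha := h.pos y
    have h1 := hφ.2 y
    have : 0 ≤ expWeight a L y * ((a y * deriv φ y + L * φ y) - source G v β lam L φ y) :=
      mul_nonneg (h.expWeight_pos y).le (by unfold source; linarith)
    refine this.trans_eq ?_
    unfold expWeight
    field_simp
    ring
  have := h.nonneg_of_monotone (C := C + M) hL hmono (fun y => by
    refine (abs_sub _ _).trans ?_
    rw [abs_mul, abs_of_pos (Real.exp_pos _), add_mul, mul_comm C]
    exact add_le_add (mul_le_mul_of_nonneg_left (hC y) (Real.exp_pos _).le) (hM y)) x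
  unfold linearSolution
  rw [Real.exp_neg, ← div_eq_inv_mul, div_le_iff₀ (Real.exp_pos _)]
  linarith

lemma contDiff_one_of_hasDerivAt {f f' : ℝ → ℝ} (hf : ∀ x, HasDerivAt f (f' x) x)
    (hf' : Continuous f') : ContDiff ℝ 1 f := by
  rw [contDiff_one_iff_deriv]
  refine ⟨fun x => (hf x).differentiableAt, ?_⟩
  rwa [show deriv f = f' from funext fun x => (hf x).deriv]

/-- Fixed points of `linearSolution` solve the nonlinear equation. -/
lemma IsCoeff.isBoundedC1Solution_of_fixed (h : IsCoeff a v) (hG : LipOnBounded G) (hβ : 0 < β)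
    (hL : 0 < L) (hφ : Measurable φ) (hC : ∀ s, |φ s| ≤ C)
    (hfix : ∀ x, linearSolution G a v β lam L φ x = φ x) :
    IsBoundedC1Solution G a v β lam φ := by
  have hint := h.integrableOn_weighted_source (lam := lam) hG hβ hL hφ hC
  have hφeq : φ = linearSolution G a v β lam L φ := funext fun x => (hfix x).symm
  -- Bootstrap: a measurable fixed point is continuous, so the integrand is continuous, so the fixed
  -- point is differentiable.
  have hφc : Continuous φ := by
    rw [hφeq]
    exact (Real.continuous_exp.comp (continuous_const.mul h.continuous_clock).neg).mul
      (continuous_integral_Iic hint)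
  have hcont : Continuous fun s => expWeight a L s * source G v β lam L φ s := by
    unfold source
    exact h.continuous_expWeight.mul (((continuous_const.sub (continuous_const.mul h.cont_v)).sub
      (hG.continuous.comp hφc)).add (continuous_const.mul hφc))
  have hder : ∀ x, HasDerivAt φ ((lam - β * v x - G (φ x)) / a x) x := fun x => by
    have h1 := (((h.hasDerivAt_clock x).const_mul L).neg.exp).mul
      (hasDerivAt_integral_Iic hcont hint x)
    have h2 : HasDerivAt φ _ x := h1.congr_of_eventuallyEq (by
      exact Eventually.of_forall fun y => (hfix y).symm)
    convert h2 using 1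
    have h3 := hfix x
    unfold linearSolution at h3
    have ha := (h.pos x).ne'
    set I := ∫ s in Iic x, expWeight a L s * source G v β lam L φ s with hI
    have h4 : Real.exp (-(L * clock a x)) * Real.exp (L * clock a x) = 1 := by
      rw [← Real.exp_add]; simp
    simp only [Pi.neg_apply]
    calc _ = -(L * (1 / a x)) * φ x + source G v β lam L φ x / a x * 1 := by
          unfold source; field_simp; ring
      _ = _ := by
        rw [← h4, ← h3, expWeight]
        ring
  refine ⟨contDiff_one_of_hasDerivAt hder ?_, ⟨C, hC⟩, fun x => ?_⟩
  · exact ((continuous_const.sub (continuous_const.mul h.cont_v)).sub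
      (hG.continuous.comp hφc)).div h.cont_a fun x => (h.pos x).ne'
  · rw [(hder x).deriv]
    have ha := (h.pos x).ne'
    field_simp
    ring

lemma IsCoeff.tendsto_linearSolution (h : IsCoeff a v) (hG : LipOnBounded G) (hβ : 0 < β)
    (hL : 0 < L) {Φ : ℕ → ℝ → ℝ} (hΦ : ∀ n, Measurable (Φ n)) (hC : ∀ n s, |Φ n s| ≤ C)
    (hlim : ∀ s, Tendsto (fun n => Φ n s) atTop (𝓝 (φ s))) (x : ℝ) :
    Tendsto (fun n => linearSolution G a v β lam L (Φ n) x) atTop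
      (𝓝 (linearSolution G a v β lam L φ x)) := by
  obtain ⟨M, hM⟩ := h.exists_source_bound (lam := lam) (C := C) hG hβ hL
  refine Tendsto.const_mul _ ?_
  refine tendsto_integral_of_dominated_convergence (fun s => M * expWeight a L s)
    (fun n => (h.integrableOn_weighted_source hG hβ hL (hΦ n) (hC n) x).aestronglyMeasurable)
    ((h.integrableOn_expWeight hL x).const_mul M) (fun n => ae_of_all _ fun s => ?_)
    (ae_of_all _ fun s => ?_)
  · rw [norm_mul, Real.norm_of_nonneg (h.expWeight_pos s).le, mul_comm]
    exact mul_le_mul_of_nonneg_right (hM _ s (hC n s)) (h.expWeight_pos s).le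
  · refine Tendsto.const_mul _ ?_
    unfold source
    exact (tendsto_const_nhds.sub ((hG.continuous.tendsto _).comp (hlim s))).add
      ((hlim s).const_mul L)

lemma clock_shift (h : IsCoeff a v) (x s : ℝ) :
    clock (fun t => a (t + x)) s = clock a (s + x) - clock a x := by
  rw [← h.clock_eq_integral, clock, intervalIntegral.integral_comp_add_right (fun t => 1 / a t),
    zero_add]

/-- Shifting the origin of the clock multiplies the kernel by `exp (-(L * clock a x))`, which is the
prefactor of the operator. Commutation with translations is what makes the iterates stationary. -/
lemma IsCoeff.linearSolution_shift (h : IsCoeff a v) (x : ℝ) :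
    linearSolution G (fun t => a (t + x)) (fun t => v (t + x)) β lam L (fun t => φ (t + x)) 0
      = linearSolution G a v β lam L φ x := by
  unfold linearSolution
  have h1 : ∀ s, expWeight (fun t => a (t + x)) L s *
      source G (fun t => v (t + x)) β lam L (fun t => φ (t + x)) s =
      Real.exp (-(L * clock a x)) *
        (fun s => expWeight a L s * source G v β lam L φ s) (s + x) := fun s => by
    unfold expWeight source
    rw [clock_shift h, mul_sub, sub_eq_add_neg, Real.exp_add]
    ring
  simp only [clock_zero, mul_zero, neg_zero, Real.exp_zero, one_mul]
  simp_rw [h1]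
  rw [integral_const_mul]
  congr 1
  rw [← integral_indicator measurableSet_Iic, ← integral_indicator measurableSet_Iic]
  refine Eq.trans ?_ (integral_add_right_eq_self _ x)
  refine integral_congr_ae (ae_of_all _ fun s => ?_)
  simp [indicator]

end

/-! ### Stationary media: solutions between barriers, and the ergodic dichotomy. -/

/-- A measurable action of `ℝ`. -/
structure IsFlow {Ω : Type*} [MeasurableSpace Ω] (τ : ℝ → Ω → Ω) : Prop where
  measurable_uncurry : Measurable (fun z : ℝ × Ω => τ z.1 z.2)
  zero : ∀ ω, τ 0 ω = ω
  add : ∀ x y ω, τ (x + y) ω = τ x (τ y ω)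

/-- Stationary coefficients, each realization of which is continuous with values in `(0, 1]` and
`[0, 1]`. -/
structure IsMedium {Ω : Type*} [MeasurableSpace Ω] (τ : ℝ → Ω → Ω) (a V : ℝ → Ω → ℝ) :
    Prop where
  stat_a : IsStationaryProcess τ a
  stat_V : IsStationaryProcess τ V
  coeff : ∀ ω, IsCoeff (fun x => a x ω) (fun x => V x ω)

section

variable {Ω : Type*} [MeasurableSpace Ω] {P : Measure Ω} {τ : ℝ → Ω → Ω} {a V : ℝ → Ω → ℝ}
  {G : ℝ → ℝ} {β lam : ℝ}

lemma IsErgodicFlow.isFlow (h : IsErgodicFlow P τ) : IsFlow τ :=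
  ⟨h.measurable_uncurry, h.zero, h.add⟩

lemma IsFlow.reflect (h : IsFlow τ) : IsFlow fun x => τ (-x) where
  measurable_uncurry := h.measurable_uncurry.comp (measurable_fst.neg.prodMk measurable_snd)
  zero ω := by simpa using h.zero ω
  add x y ω := by rw [neg_add, h.add]

lemma IsFlow.isStationaryProcess (h : IsFlow τ) {φ : Ω → ℝ} (hφ : Measurable φ) :
    IsStationaryProcess τ fun x ω => φ (τ x ω) :=
  ⟨hφ.comp h.measurable_uncurry, fun x ω => by rw [h.zero]⟩

lemma isStationaryProcess_const (τ : ℝ → Ω → Ω) (p : ℝ) :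
    IsStationaryProcess τ fun _ _ => p :=
  ⟨measurable_const, fun _ _ => rfl⟩

lemma IsStationaryProcess.measurable {f : ℝ → Ω → ℝ} (hf : IsStationaryProcess τ f) (x : ℝ) :
    Measurable (f x) :=
  hf.measurable_uncurry.comp measurable_prodMk_left

lemma IsStationaryProcess.apply_flow {f : ℝ → Ω → ℝ} (hf : IsStationaryProcess τ f)
    (h : IsFlow τ) (x y : ℝ) (ω : Ω) : f x (τ y ω) = f (x + y) ω := by
  rw [hf.stationary x, hf.stationary (x + y), h.add]

lemma IsStationaryProcess.reflect {f : ℝ → Ω → ℝ} (hf : IsStationaryProcess τ f) :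
    IsStationaryProcess (fun x => τ (-x)) fun x ω => f (-x) ω where
  measurable_uncurry := hf.measurable_uncurry.comp (measurable_fst.neg.prodMk measurable_snd)
  stationary x ω := by rw [neg_zero, hf.stationary]

lemma IsStationaryProcess.neg {f : ℝ → Ω → ℝ} (hf : IsStationaryProcess τ f) :
    IsStationaryProcess τ fun x ω => -f x ω where
  measurable_uncurry := hf.measurable_uncurry.neg
  stationary x ω := by rw [hf.stationary]

lemma IsMedium.reflect (h : IsMedium τ a V) :
    IsMedium (fun x => τ (-x)) (fun x ω => a (-x) ω) (fun x ω => V (-x) ω) :=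
  ⟨h.stat_a.reflect, h.stat_V.reflect, fun ω => (h.coeff ω).reflect⟩

lemma IsMedium.measurable_clock (h : IsMedium τ a V) :
    Measurable fun z : ℝ × Ω => clock (fun x => a x z.2) z.1 := by
  refine (measurable_uncurry_of_continuous_of_measurable
    (u := fun (s : ℝ) (ω : Ω) => clock (fun x => a x ω) s)
    (fun ω => (h.coeff ω).continuous_clock) fun s => ?_)
  have hm : StronglyMeasurable fun z : Ω × ℝ => 1 / a z.2 z.1 :=
    ((measurable_const.div h.stat_a.measurable_uncurry).comp measurable_swap).stronglyMeasurable
  -- An interval integral is a difference of two set integrals, each measurable in `ω`.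
  exact (hm.integral_prod_right'.sub hm.integral_prod_right').measurable

/-- Monotone iteration with `linearSolution`, started from `φ`. -/
noncomputable def iterate (τ : ℝ → Ω → Ω) (G : ℝ → ℝ) (a V : ℝ → Ω → ℝ) (β lam L : ℝ)
    (φ : Ω → ℝ) : ℕ → Ω → ℝ
  | 0 => φ
  | k + 1 => fun ω => linearSolution G (fun x => a x ω) (fun x => V x ω) β lam L
      (fun s => iterate τ G a V β lam L φ k (τ s ω)) 0

lemma IsMedium.measurable_iterate (h : IsMedium τ a V) (hτ : IsFlow τ) (hG : LipOnBounded G)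
    (L : ℝ) {φ : Ω → ℝ} (hφ : Measurable φ) (k : ℕ) :
    Measurable (iterate τ G a V β lam L φ k) := by
  induction k with
  | zero => exact hφ
  | succ k ih =>
    have hclock := h.measurable_clock
    have hcomp : Measurable fun z : ℝ × Ω => iterate τ G a V β lam L φ k (τ z.1 z.2) :=
      ih.comp hτ.measurable_uncurry
    have hint : Measurable fun z : ℝ × Ω => expWeight (fun x => a x z.2) L z.1 *
        source G (fun x => V x z.2) β lam L
          (fun s => iterate τ G a V β lam L φ k (τ s z.2)) z.1 := by
      unfold expWeight source
      exact ((hclock.const_mul L).exp.div h.stat_a.measurable_uncurry).mul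
        (((measurable_const.sub (h.stat_V.measurable_uncurry.const_mul β)).sub
          (hG.continuous.measurable.comp hcomp)).add (hcomp.const_mul L))
    have h2 := (hint.comp measurable_swap).stronglyMeasurable.integral_prod_right'
      (ν := volume.restrict (Iic (0:ℝ)))
    unfold iterate linearSolution
    simp only [clock_zero, mul_zero, neg_zero, Real.exp_zero, one_mul]
    exact h2.measurable

/-- The iterates are functions on `Ω`. Read along an orbit, one iteration is the deterministic
operator applied to the path, and this holds for every `ω`. -/
lemma IsMedium.iterate_succ_flow (h : IsMedium τ a V) (hτ : IsFlow τ) (L : ℝ) (φ : Ω → ℝ) (k : ℕ)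
    (x : ℝ) (ω : Ω) : iterate τ G a V β lam L φ (k + 1) (τ x ω) =
      linearSolution G (fun x => a x ω) (fun x => V x ω) β lam L
        (fun s => iterate τ G a V β lam L φ k (τ s ω)) x := by
  rw [← (h.coeff ω).linearSolution_shift]
  simp only [iterate, h.stat_a.apply_flow hτ, h.stat_V.apply_flow hτ, ← hτ.add]

/-- Between an ordered pair of a stationary subsolution and a stationary supersolution there is a
stationary solution. -/
lemma IsMedium.exists_between (h : IsMedium τ a V) (hτ : IsFlow τ) (hG : LipOnBounded G)
    (hβ : 0 < β) {m₁ m₂ : ℝ → Ω → ℝ}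
    (hm₂ : IsStationaryProcess τ m₂) {C : ℝ} (hC₁ : ∀ᵐ ω ∂P, ∀ x, |m₁ x ω| ≤ C)
    (hC₂ : ∀ᵐ ω ∂P, ∀ x, |m₂ x ω| ≤ C)
    (hsub : ∀ᵐ ω ∂P, IsSub G (fun x => a x ω) (fun x => V x ω) β lam fun x => m₁ x ω)
    (hsup : ∀ᵐ ω ∂P, IsSuper G (fun x => a x ω) (fun x => V x ω) β lam fun x => m₂ x ω)
    (hle : ∀ᵐ ω ∂P, ∀ x, m₁ x ω ≤ m₂ x ω) :
    ∃ f : ℝ → Ω → ℝ, IsStationaryProcess τ f ∧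
      (∀ᵐ ω ∂P, IsBoundedC1Solution G (fun x => a x ω) (fun x => V x ω) β lam fun x => f x ω) ∧
      ∀ᵐ ω ∂P, ∀ x, m₁ x ω ≤ f x ω ∧ f x ω ≤ m₂ x ω := by
  obtain ⟨L, hL, hLip⟩ := hG C
  set it := iterate τ G a V β lam L (m₂ 0) with hit
  have hitm : ∀ k, Measurable (it k) := h.measurable_iterate hτ hG L (hm₂.measurable 0)
  have hpath : ∀ k ω, Measurable fun s => it k (τ s ω) := fun k ω =>
    (hitm k).comp (hτ.measurable_uncurry.comp measurable_prodMk_right)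
  refine ⟨fun x ω => ⨅ k, it k (τ x ω),
    -- Defining the infimum for all `ω` makes stationarity hold everywhere; the value on the
    -- exceptional null set is irrelevant.
    hτ.isStationaryProcess (φ := fun ω => ⨅ k, it k ω) (Measurable.iInf hitm), ?_⟩
  rw [← eventually_and]
  filter_upwards [hC₁, hC₂, hsub, hsup, hle] with ω hC₁ hC₂ hsub hsup hle
  have hstep := fun k x => h.iterate_succ_flow (G := G) (β := β) (lam := lam) hτ L (m₂ 0) k x ω
  have h0 : ∀ x, it 0 (τ x ω) = m₂ x ω := fun x => (hm₂.stationary x ω).symm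
  have hco := h.coeff ω
  have habs : ∀ {p q r : ℝ}, |p| ≤ C → |r| ≤ C → p ≤ q → q ≤ r → |q| ≤ C := fun hp hr h1 h2 =>
    abs_le.2 ⟨(abs_le.1 hp).1.trans h1, h2.trans (abs_le.1 hr).2⟩
  -- Started at the supersolution, the iterates decrease and stay above `m₁`, by monotonicity of the
  -- operator; the limit is a fixed point by dominated convergence.
  have key : ∀ k, (∀ x, m₁ x ω ≤ it (k + 1) (τ x ω)) ∧
      (∀ x, it (k + 1) (τ x ω) ≤ it k (τ x ω)) ∧ ∀ x, m₁ x ω ≤ it k (τ x ω) ∧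
        it k (τ x ω) ≤ m₂ x ω := by
    have hlow : ∀ k, (∀ x, m₁ x ω ≤ it k (τ x ω) ∧ it k (τ x ω) ≤ m₂ x ω) →
        ∀ x, m₁ x ω ≤ it (k + 1) (τ x ω) := fun k hk x => by
      rw [hit, hstep]
      exact (hco.le_linearSolution hG hβ hL hsub hC₁ x).trans
        (hco.linearSolution_mono hG hβ hL hLip hsub.1.continuous.measurable hC₁
          (hpath k ω) (fun s => habs (hC₁ s) (hC₂ s) (hk s).1 (hk s).2) (fun s => (hk s).1) x)
    intro k
    induction k with
    | zero =>
      have hb : ∀ x, m₁ x ω ≤ it 0 (τ x ω) ∧ it 0 (τ x ω) ≤ m₂ x ω := fun x => by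
        rw [h0]; exact ⟨hle x, le_rfl⟩
      refine ⟨hlow 0 hb, fun x => ?_, hb⟩
      rw [h0, hit, hstep]
      have : (fun s => iterate τ G a V β lam L (m₂ 0) 0 (τ s ω)) = fun s => m₂ s ω := funext h0
      rw [this]
      exact hco.linearSolution_le hG hβ hL hsup hC₂ x
    | succ k ih =>
      obtain ⟨h1, h2, h3⟩ := ih
      have hb : ∀ x, m₁ x ω ≤ it (k + 1) (τ x ω) ∧ it (k + 1) (τ x ω) ≤ m₂ x ω := fun x =>
        ⟨h1 x, (h2 x).trans (h3 x).2⟩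
      refine ⟨hlow _ hb, fun x => ?_, hb⟩
      rw [hit, hstep, hstep]
      exact hco.linearSolution_mono hG hβ hL hLip (hpath (k + 1) ω)
        (fun s => habs (hC₁ s) (hC₂ s) (hb s).1 (hb s).2) (hpath k ω)
        (fun s => habs (hC₁ s) (hC₂ s) (h3 s).1 (h3 s).2) h2 x
  have hbdd : ∀ x, BddBelow (range fun k => it k (τ x ω)) := fun x =>
    ⟨m₁ x ω, by rintro _ ⟨k, rfl⟩; exact ((key k).2.2 x).1⟩
  have hlim : ∀ x, Tendsto (fun k => it k (τ x ω)) atTop (𝓝 (⨅ k, it k (τ x ω))) := fun x =>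
    tendsto_atTop_ciInf (antitone_nat_of_succ_le fun k => (key k).2.1 x) (hbdd x)
  have hbetween : ∀ x, m₁ x ω ≤ (⨅ k, it k (τ x ω)) ∧ (⨅ k, it k (τ x ω)) ≤ m₂ x ω := fun x =>
    ⟨le_ciInf fun k => ((key k).2.2 x).1, (ciInf_le (hbdd x) 0).trans_eq (h0 x)⟩
  have hbound : ∀ x, |⨅ k, it k (τ x ω)| ≤ C := fun x =>
    habs (hC₁ x) (hC₂ x) (hbetween x).1 (hbetween x).2
  refine ⟨hco.isBoundedC1Solution_of_fixed hG hβ hL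
    (Measurable.iInf fun k => hpath k ω) hbound fun x => ?_, hbetween⟩
  refine tendsto_nhds_unique (hco.tendsto_linearSolution hG hβ hL (fun k => hpath k ω)
    (fun k s => habs (hC₁ s) (hC₂ s) ((key k).2.2 s).1 ((key k).2.2 s).2) hlim x) ?_
  exact ((tendsto_add_atTop_iff_nat 1).2 (hlim x)).congr fun k => hstep k x

/-- The variant of `IsMedium.exists_between` with the supersolution below the subsolution. -/
lemma IsMedium.exists_between_of_super_le_sub (h : IsMedium τ a V) (hτ : IsFlow τ)
    (hG : LipOnBounded G) (hβ : 0 < β) {m₁ m₂ : ℝ → Ω → ℝ} (hm₁ : IsStationaryProcess τ m₁)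
    {C : ℝ} (hC₁ : ∀ᵐ ω ∂P, ∀ x, |m₁ x ω| ≤ C)
    (hC₂ : ∀ᵐ ω ∂P, ∀ x, |m₂ x ω| ≤ C)
    (hsup : ∀ᵐ ω ∂P, IsSuper G (fun x => a x ω) (fun x => V x ω) β lam fun x => m₁ x ω)
    (hsub : ∀ᵐ ω ∂P, IsSub G (fun x => a x ω) (fun x => V x ω) β lam fun x => m₂ x ω)
    (hle : ∀ᵐ ω ∂P, ∀ x, m₁ x ω ≤ m₂ x ω) :
    ∃ f : ℝ → Ω → ℝ, IsStationaryProcess τ f ∧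
      (∀ᵐ ω ∂P, IsBoundedC1Solution G (fun x => a x ω) (fun x => V x ω) β lam fun x => f x ω) ∧
      ∀ᵐ ω ∂P, ∀ x, m₁ x ω ≤ f x ω ∧ f x ω ≤ m₂ x ω := by
  obtain ⟨g, hg, hgsol, hgb⟩ := h.reflect.exists_between (P := P) (lam := lam) hτ.reflect
    hG.comp_neg hβ hm₁.reflect.neg (C := C)
    (hC₂.mono fun ω H x => by rw [abs_neg]; exact H _)
    (hC₁.mono fun ω H x => by rw [abs_neg]; exact H _)
    (hsub.mono fun ω H => H.reflect) (hsup.mono fun ω H => H.reflect)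
    (hle.mono fun ω H x => neg_le_neg (H _))
  have hst := hg.reflect.neg
  simp only [neg_neg] at hst
  refine ⟨fun x ω => -g (-x) ω, hst, ?_, ?_⟩
  · filter_upwards [hgsol] with ω H
    simpa only [neg_neg] using H.reflect
  · filter_upwards [hgb] with ω H x
    have := H (-x)
    simp only [neg_neg] at this
    constructor <;> linarith

/-- An event that, along almost every orbit, once entered is never left has almost surely
constant indicator along the orbit. -/
lemma IsErgodicFlow.dichotomy [IsProbabilityMeasure P] (hτ : IsErgodicFlow P τ) {E : Set Ω}
    (hE : MeasurableSet E) (hfwd : ∀ᵐ ω ∂P, ∀ x y, x ≤ y → τ x ω ∈ E → τ y ω ∈ E) :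
    (∀ᵐ ω ∂P, ∀ x, τ x ω ∈ E) ∨ ∀ᵐ ω ∂P, ∀ x, τ x ω ∉ E := by
  have hpre : ∀ x, P (τ x ⁻¹' E) = P E := fun x =>
    (hτ.measurePreserving x).measure_preimage hE.nullMeasurableSet
  have hinv : ∀ x y, x ≤ y → ∀ᵐ ω ∂P, (τ y ω ∈ E ↔ τ x ω ∈ E) := fun x y hxy => by
    -- The two preimages are nested and have the same finite measure, so they agree almost surely.
    have hsub : τ x ⁻¹' E ≤ᵐ[P] τ y ⁻¹' E := by
      filter_upwards [hfwd] with ω H using H x y hxy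
    have := ae_eq_of_ae_subset_of_measure_ge hsub (by rw [hpre, hpre])
      ((hτ.measurePreserving x).measurable hE).nullMeasurableSet (measure_ne_top _ _)
    filter_upwards [this] with ω H
    exact (iff_of_eq H).symm
  have hinv0 : ∀ x, ∀ᵐ ω ∂P, (τ x ω ∈ E ↔ ω ∈ E) := fun x => by
    rcases le_total 0 x with hx | hx
    · filter_upwards [hinv 0 x hx] with ω H
      rwa [hτ.zero] at H
    · filter_upwards [hinv x 0 hx] with ω H
      rw [hτ.zero] at H
      exact H.symm
  obtain ⟨c, hc⟩ := hτ.ergodic (E.indicator fun _ => (1:ℝ)) (measurable_const.indicator hE)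
    fun x => by
      filter_upwards [hinv0 x] with ω H
      by_cases hω : ω ∈ E
      · rw [indicator_of_mem hω, indicator_of_mem (H.2 hω)]
      · rw [indicator_of_notMem hω, indicator_of_notMem fun h' => hω (H.1 h')]
  -- Integer times share one null set; forward invariance, applied from `⌊x⌋` or up to `⌈x⌉`, then
  -- covers all real times.
  have hall : ∀ᵐ ω ∂P, ∀ n : ℤ, (τ n ω ∈ E ↔ ω ∈ E) := ae_all_iff.2 fun n => hinv0 n
  by_cases h1 : c = 1
  · left
    filter_upwards [hc, hall, hfwd] with ω Hc Hn Hf x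
    have hω : ω ∈ E := by
      by_contra hn
      rw [indicator_of_notMem hn, h1] at Hc
      exact zero_ne_one Hc
    exact Hf ⌊x⌋ x (Int.floor_le x) ((Hn _).2 hω)
  · right
    filter_upwards [hc, hall, hfwd] with ω Hc Hn Hf x hx
    have hω : ω ∈ E := (Hn _).1 (Hf x ⌈x⌉ (Int.le_ceil x) hx)
    rw [indicator_of_mem hω] at Hc
    exact h1 Hc.symm

end

/-! ### Correctors: order, uniqueness of the level, extremal means. -/

/-- Stationary processes whose paths are almost surely bounded solutions at level `lam`. -/
structure IsStationarySolution {Ω : Type*} [MeasurableSpace Ω] (P : Measure Ω)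
    (τ : ℝ → Ω → Ω) (a V : ℝ → Ω → ℝ) (β : ℝ) (G : ℝ → ℝ) (lam : ℝ) (f : ℝ → Ω → ℝ) :
    Prop where
  stat : IsStationaryProcess τ f
  sol : ∀ᵐ ω ∂P,
    IsBoundedC1Solution G (fun x => a x ω) (fun x => V x ω) β lam fun x => f x ω

/-- Stationary solutions with a deterministic bound `C`. -/
structure IsCorrector {Ω : Type*} [MeasurableSpace Ω] (P : Measure Ω)
    (τ : ℝ → Ω → Ω) (a V : ℝ → Ω → ℝ) (β : ℝ) (G : ℝ → ℝ) (lam C : ℝ) (f : ℝ → Ω → ℝ) : Prop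
    extends IsStationarySolution P τ a V β G lam f where
  bound : ∀ᵐ ω ∂P, ∀ x, |f x ω| ≤ C

section

variable {Ω : Type*} [MeasurableSpace Ω] {P : Measure Ω} {τ : ℝ → Ω → Ω} {a V : ℝ → Ω → ℝ}
  {G : ℝ → ℝ} {β lam lam₁ lam₂ C C₁ C₂ : ℝ} {f g : ℝ → Ω → ℝ}

lemma IsErgodicFlow.reflect (h : IsErgodicFlow P τ) : IsErgodicFlow P fun x => τ (-x) where
  measurable_uncurry := h.isFlow.reflect.measurable_uncurry
  zero := h.isFlow.reflect.zero
  add := h.isFlow.reflect.add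
  measurePreserving x := h.measurePreserving (-x)
  ergodic φ hφ hinv := h.ergodic φ hφ fun x => by simpa using hinv (-x)

lemma IsCorrector.reflect (hf : IsCorrector P τ a V β G lam C f) :
    IsCorrector P (fun x => τ (-x)) (fun x ω => a (-x) ω) (fun x ω => V (-x) ω) β
      (fun p => G (-p)) lam C fun x ω => -f (-x) ω where
  stat := hf.stat.reflect.neg
  sol := hf.sol.mono fun _ H => H.reflect
  bound := hf.bound.mono fun _ H x => by rw [abs_neg]; exact H _

/-- A stationary subsolution and a stationary supersolution are ordered. -/
lemma order_of_sub_super [IsProbabilityMeasure P] (hτ : IsErgodicFlow P τ) (hM : IsMedium τ a V)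
    (hG : LipOnBounded G) (hf : IsStationaryProcess τ f) (hg : IsStationaryProcess τ g)
    (hfs : ∀ᵐ ω ∂P, IsSub G (fun x => a x ω) (fun x => V x ω) β lam fun x => f x ω)
    (hgs : ∀ᵐ ω ∂P, IsSuper G (fun x => a x ω) (fun x => V x ω) β lam fun x => g x ω)
    (hfb : ∀ᵐ ω ∂P, ∃ C, ∀ x, |f x ω| ≤ C) (hgb : ∀ᵐ ω ∂P, ∃ C, ∀ x, |g x ω| ≤ C) :
    (∀ᵐ ω ∂P, ∀ x, f x ω ≤ g x ω) ∨ ∀ᵐ ω ∂P, ∀ x, g x ω < f x ω := by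
  have hE : MeasurableSet {ω | f 0 ω ≤ g 0 ω} :=
    measurableSet_le (hf.measurable 0) (hg.measurable 0)
  have hmem : ∀ x ω, τ x ω ∈ {ω | f 0 ω ≤ g 0 ω} ↔ f x ω ≤ g x ω := fun x ω => by
    rw [mem_ofPred_eq, ← hf.stationary, ← hg.stationary]
  rcases hτ.dichotomy hE (by
    filter_upwards [hfs, hgs, hfb, hgb] with ω h1 h2 ⟨C₁, h3⟩ ⟨C₂, h4⟩ x y hxy hx
    replace hx := (hmem x ω).1 hx
    refine (hmem y ω).2 ?_
    exact (hM.coeff ω).comparison hG h1 h2 (C := max C₁ C₂)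
      (fun x => (h3 x).trans (le_max_left _ _)) (fun x => (h4 x).trans (le_max_right _ _)) hx hxy)
    with h | h
  · exact Or.inl (h.mono fun ω H x => (hmem x ω).1 (H x))
  · exact Or.inr (h.mono fun ω H x => not_le.1 fun hn => H x ((hmem x ω).2 hn))

lemma IsStationarySolution.order [IsProbabilityMeasure P] (hτ : IsErgodicFlow P τ)
    (hM : IsMedium τ a V) (hG : LipOnBounded G) (hl : lam₁ ≤ lam₂)
    (hf : IsStationarySolution P τ a V β G lam₁ f) (hg : IsStationarySolution P τ a V β G lam₂ g) :
    (∀ᵐ ω ∂P, ∀ x, f x ω ≤ g x ω) ∨ ∀ᵐ ω ∂P, ∀ x, g x ω < f x ω :=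
  order_of_sub_super hτ hM hG hf.stat hg.stat (hf.sol.mono fun _ H => H.isSub hl)
    (hg.sol.mono fun _ H => H.isSuper le_rfl) (hf.sol.mono fun _ H => H.2.1)
    (hg.sol.mono fun _ H => H.2.1)

lemma not_ae_lt_of_integral_le [IsProbabilityMeasure P] {X Y : Ω → ℝ} (hX : Integrable X P)
    (hY : Integrable Y P) (hle : ∫ ω, X ω ∂P ≤ ∫ ω, Y ω ∂P) : ¬ ∀ᵐ ω ∂P, Y ω < X ω := by
  intro h
  have h1 : Y ≤ᵐ[P] X := h.mono fun _ H => H.le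
  have h2 : ∫ ω, Y ω ∂P = ∫ ω, X ω ∂P := le_antisymm (integral_mono_ae hY hX h1) hle
  have h3 := (integral_eq_iff_of_ae_le hY hX h1).1 h2
  obtain ⟨ω, hω, hω'⟩ := (h.and h3).exists
  exact hω.ne hω'

/-- Stationary solutions at two levels are uniformly separated along almost every orbit, in the
order of their means. -/
lemma IsStationarySolution.separation [IsProbabilityMeasure P] (hτ : IsErgodicFlow P τ)
    (hM : IsMedium τ a V) (hG : LipOnBounded G) (hl : lam₁ ≠ lam₂)
    (hf : IsStationarySolution P τ a V β G lam₁ f) (hg : IsStationarySolution P τ a V β G lam₂ g) :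
    (∀ᵐ ω ∂P, ∃ ε > 0, ∀ x, f x ω + ε ≤ g x ω) ∨
      ∀ᵐ ω ∂P, ∃ ε > 0, ∀ x, g x ω + ε ≤ f x ω := by
  wlog hlt : lam₁ < lam₂ generalizing lam₁ lam₂ f g
  · exact (this hl.symm hg hf (lt_of_le_of_ne (not_lt.1 hlt) hl.symm)).symm
  rcases hf.order hτ hM hG hlt.le hg with h | h
  · left
    filter_upwards [h, hf.sol, hg.sol] with ω h1 h2 h3
    exact (hM.coeff ω).separation_of_le hG hlt h2 h3 h1
  · right
    filter_upwards [h, hf.sol, hg.sol] with ω h1 h2 h3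
    exact (hM.coeff ω).separation_of_ge hG hlt h2 h3 fun x => (h1 x).le

lemma IsStationarySolution.separation_of_mean_le [IsProbabilityMeasure P]
    (hτ : IsErgodicFlow P τ) (hM : IsMedium τ a V) (hG : LipOnBounded G) (hl : lam₁ ≠ lam₂)
    (hf : IsStationarySolution P τ a V β G lam₁ f) (hg : IsStationarySolution P τ a V β G lam₂ g)
    (hfi : Integrable (fun ω => f 0 ω) P) (hgi : Integrable (fun ω => g 0 ω) P)
    (hle : ∫ ω, f 0 ω ∂P ≤ ∫ ω, g 0 ω ∂P) :
    ∀ᵐ ω ∂P, ∃ ε > 0, ∀ x, f x ω + ε ≤ g x ω := by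
  rcases hf.separation hτ hM hG hl hg with h | h
  · exact h
  · refine absurd ?_ (not_ae_lt_of_integral_le hfi hgi hle)
    filter_upwards [h] with ω ⟨ε, hε, H⟩
    have := H 0
    linarith

/-- At a given slope there is at most one level with a corrector pair. -/
lemma IsCorrectorPair.level_unique [IsProbabilityMeasure P] (hτ : IsErgodicFlow P τ)
    (hM : IsMedium τ a V) (hG : LipOnBounded G) {θ : ℝ} {f₁ f₂ g₁ g₂ : ℝ → Ω → ℝ}
    (hf : IsCorrectorPair P τ a V β G θ lam₁ f₁ f₂)
    (hg : IsCorrectorPair P τ a V β G θ lam₂ g₁ g₂) : lam₁ = lam₂ := by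
  by_contra hl
  have hf₁ : IsStationarySolution P τ a V β G lam₁ f₁ := ⟨hf.stationary_lower, hf.solution_lower⟩
  have hf₂ : IsStationarySolution P τ a V β G lam₁ f₂ := ⟨hf.stationary_upper, hf.solution_upper⟩
  have hg₁ : IsStationarySolution P τ a V β G lam₂ g₁ := ⟨hg.stationary_lower, hg.solution_lower⟩
  have hg₂ : IsStationarySolution P τ a V β G lam₂ g₂ := ⟨hg.stationary_upper, hg.solution_upper⟩
  have h12 := hf₁.separation_of_mean_le hτ hM hG hl hg₂ hf.integrable_lower hg.integrable_upper
    (hf.mean_lower.trans hg.mean_upper)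
  have h21 := hg₁.separation_of_mean_le hτ hM hG (Ne.symm hl) hf₂ hg.integrable_lower
    hf.integrable_upper (hg.mean_lower.trans hf.mean_upper)
  -- A process uniformly separated from both members of a pair and lying between them keeps their
  -- gap away from zero.
  have key : ∀ {u₁ u₂ w : ℝ → Ω → ℝ} {ω : Ω}, IsGLB (range fun x => u₂ x ω - u₁ x ω) 0 →
      (∃ ε > 0, ∀ x, u₁ x ω + ε ≤ w x ω) → (∃ ε > 0, ∀ x, w x ω + ε ≤ u₂ x ω) → False := by
    rintro u₁ u₂ w ω hglb ⟨ε, hε, h1⟩ ⟨δ, hδ, h2⟩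
    have : ε ≤ 0 := hglb.2 (by
      rintro _ ⟨x, rfl⟩
      have := h1 x
      have := h2 x
      simp only
      linarith)
    linarith
  rcases hf₁.separation hτ hM hG hl hg₁ with h11 | h11
  · obtain ⟨ω, h1, h2, h3⟩ := (h11.and (h21.and hf.inf_eq_zero)).exists
    exact key h3 h1 h2
  · obtain ⟨ω, h1, h2, h3⟩ := (h11.and (h12.and hg.inf_eq_zero)).exists
    exact key h3 h1 h2

lemma IsCorrector.integrable [IsFiniteMeasure P] (hf : IsCorrector P τ a V β G lam C f) :
    Integrable (fun ω => f 0 ω) P :=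
  Integrable.of_bound (hf.stat.measurable 0).aestronglyMeasurable C (hf.bound.mono fun _ H => H 0)

lemma IsStationarySolution.ae_continuous (hf : IsStationarySolution P τ a V β G lam f) :
    ∀ᵐ ω ∂P, Continuous fun x => f x ω :=
  hf.sol.mono fun _ H => H.1.continuous

/-- Ordered correctors with the same mean coincide. -/
lemma IsCorrector.eq_of_mean_eq [IsProbabilityMeasure P] (hτ : IsErgodicFlow P τ)
    (hf : IsCorrector P τ a V β G lam₁ C₁ f) (hg : IsCorrector P τ a V β G lam₂ C₂ g)
    (hle : ∀ᵐ ω ∂P, ∀ x, f x ω ≤ g x ω) (hmean : ∫ ω, f 0 ω ∂P = ∫ ω, g 0 ω ∂P) :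
    ∀ᵐ ω ∂P, ∀ x, f x ω = g x ω := by
  have h0 : ∀ᵐ ω ∂P, f 0 ω = g 0 ω :=
    (integral_eq_iff_of_ae_le hf.integrable hg.integrable (hle.mono fun _ H => H 0)).1 hmean
  have hq : ∀ᵐ ω ∂P, ∀ q : ℚ, f q ω = g q ω := ae_all_iff.2 fun q => by
    filter_upwards [(hτ.measurePreserving q).quasiMeasurePreserving.ae h0] with ω H
    rw [hf.stat.stationary, hg.stat.stationary, H]
  filter_upwards [hq, hf.ae_continuous, hg.ae_continuous] with ω H h1 h2
  exact fun x => congr_fun (h1.ext_on Rat.denseRange_cast h2 (by rintro _ ⟨q, rfl⟩; exact H q)) x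

/-- Correctors are ordered as their means. -/
lemma IsCorrector.le_of_mean_le [IsProbabilityMeasure P] (hτ : IsErgodicFlow P τ)
    (hM : IsMedium τ a V) (hG : LipOnBounded G)
    (hf : IsCorrector P τ a V β G lam₁ C₁ f) (hg : IsCorrector P τ a V β G lam₂ C₂ g)
    (hle : ∫ ω, f 0 ω ∂P ≤ ∫ ω, g 0 ω ∂P) : ∀ᵐ ω ∂P, ∀ x, f x ω ≤ g x ω := by
  rcases le_total lam₁ lam₂ with hl | hl
  · rcases hf.order hτ hM hG hl hg.toIsStationarySolution with h | h
    · exact h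
    · exact absurd (h.mono fun _ H => H 0)
        (not_ae_lt_of_integral_le hf.integrable hg.integrable hle)
  · rcases hg.order hτ hM hG hl hf.toIsStationarySolution with h | h
    -- Here comparison gives the reverse order, which agrees with the means only if the two
    -- correctors coincide.
    · have := hg.eq_of_mean_eq hτ hf h (le_antisymm (integral_mono_ae hg.integrable hf.integrable
        (h.mono fun _ H => H 0)) hle)
      exact this.mono fun _ H x => (H x).ge
    · exact h.mono fun _ H x => (H x).le

/-- The level enters the source additively and the normalized kernel has mass `1 / L`; this allows
limits along varying levels. -/
lemma IsCoeff.linearSolution_level {a v : ℝ → ℝ} (h : IsCoeff a v) (hG : LipOnBounded G)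
    (hβ : 0 < β) {L : ℝ} (hL : 0 < L) {φ : ℝ → ℝ} (hφ : Measurable φ) (hC : ∀ s, |φ s| ≤ C)
    (x : ℝ) : linearSolution G a v β lam₁ L φ x =
      linearSolution G a v β lam₂ L φ x + (lam₁ - lam₂) / L := by
  unfold linearSolution
  have h1 : ∀ s, expWeight a L s * source G v β lam₁ L φ s =
      expWeight a L s * source G v β lam₂ L φ s + expWeight a L s * (lam₁ - lam₂) := fun s => by
    unfold source; ring
  simp_rw [h1]
  rw [integral_add (h.integrableOn_weighted_source hG hβ hL hφ hC x)
    ((h.integrableOn_expWeight hL x).mul_const _), integral_mul_const, h.integral_expWeight hL,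
    mul_add]
  have h4 : Real.exp (-(L * clock a x)) * Real.exp (L * clock a x) = 1 := by
    rw [← Real.exp_add]; simp
  congr 1
  calc _ = (Real.exp (-(L * clock a x)) * Real.exp (L * clock a x)) * ((lam₁ - lam₂) / L) := by ring
    _ = _ := by rw [h4, one_mul]

/-- Pointwise limits of uniformly bounded solutions are solutions. -/
lemma IsCoeff.isBoundedC1Solution_of_tendsto {a v : ℝ → ℝ} (h : IsCoeff a v)
    (hG : LipOnBounded G) (hβ : 0 < β) {F : ℕ → ℝ → ℝ} {l : ℕ → ℝ} {φ : ℝ → ℝ}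
    (hF : ∀ n, IsBoundedC1Solution G a v β (l n) (F n)) (hC : ∀ n x, |F n x| ≤ C)
    (hl : Tendsto l atTop (𝓝 lam)) (hlim : ∀ x, Tendsto (fun n => F n x) atTop (𝓝 (φ x))) :
    IsBoundedC1Solution G a v β lam φ := by
  have hFm : ∀ n, Measurable (F n) := fun n => (hF n).1.continuous.measurable
  have hφ : Measurable φ := measurable_of_tendsto_metrizable hFm (tendsto_pi_nhds.2 hlim)
  have hφC : ∀ x, |φ x| ≤ C := fun x => le_of_tendsto' (hlim x).abs fun n => hC n x
  -- Any positive parameter serves: a solution is both a sub- and a supersolution, hence a fixed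
  -- point, and monotonicity of the operator plays no role.
  have hL : (0:ℝ) < 1 := one_pos
  refine h.isBoundedC1Solution_of_fixed hG hβ hL hφ hφC fun x => ?_
  have hfix : ∀ n, linearSolution G a v β (l n) 1 (F n) x = F n x := fun n =>
    le_antisymm (h.linearSolution_le hG hβ hL ((hF n).isSuper le_rfl) (hC n) x)
      (h.le_linearSolution hG hβ hL ((hF n).isSub le_rfl) (hC n) x)
  have h1 := (h.tendsto_linearSolution (lam := lam) hG hβ hL hFm hC hlim x).add
    ((hl.sub_const lam).div_const 1)
  rw [sub_self, zero_div, add_zero] at h1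
  refine tendsto_nhds_unique h1 ((hlim x).congr fun n => ?_)
  rw [← hfix n, h.linearSolution_level (lam₂ := lam) hG hβ hL (hFm n) (hC n)]

lemma IsCorrector.level_le [IsProbabilityMeasure P] (hM : IsMedium τ a V) (hβ : 0 < β)
    (hf : IsCorrector P τ a V β G lam C f) {M : ℝ} (hGM : ∀ p, |p| ≤ C → |G p| ≤ M) :
    lam ≤ M + β + 1 := by
  obtain ⟨ω, h1, h2⟩ := (hf.sol.and hf.bound).exists
  exact (hM.coeff ω).level_le hβ h1 fun x => (le_abs_self _).trans (hGM _ (h2 x))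

lemma IsCorrector.of_between (hf : IsStationarySolution P τ a V β G lam f)
    {m₁ m₂ : ℝ → Ω → ℝ} (h₁ : ∀ᵐ ω ∂P, ∀ x, |m₁ x ω| ≤ C) (h₂ : ∀ᵐ ω ∂P, ∀ x, |m₂ x ω| ≤ C)
    (hb : ∀ᵐ ω ∂P, ∀ x, m₁ x ω ≤ f x ω ∧ f x ω ≤ m₂ x ω) : IsCorrector P τ a V β G lam C f where
  toIsStationarySolution := hf
  bound := by
    filter_upwards [h₁, h₂, hb] with ω h1 h2 h3 x
    exact abs_le.2 ⟨(abs_le.1 (h1 x)).1.trans (h3 x).1, (h3 x).2.trans (abs_le.1 (h2 x)).2⟩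

lemma IsCorrector.mono (hf : IsCorrector P τ a V β G lam C₁ f) (h : C₁ ≤ C₂) :
    IsCorrector P τ a V β G lam C₂ f :=
  ⟨hf.toIsStationarySolution, hf.bound.mono fun _ H x => (H x).trans h⟩

/-- Among the correctors of level at least `μ` and mean at most `θ` one has the largest mean. -/
lemma exists_corrector_max_mean [IsProbabilityMeasure P] (hτ : IsErgodicFlow P τ)
    (hM : IsMedium τ a V) (hG : LipOnBounded G) (hβ : 0 < β) {μ θ : ℝ}
    (hlow : ∃ lam C f, μ ≤ lam ∧ IsCorrector P τ a V β G lam C f ∧ ∫ ω, f 0 ω ∂P ≤ θ)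
    (hupp : ∃ lam C f, μ ≤ lam ∧ IsCorrector P τ a V β G lam C f ∧ θ ≤ ∫ ω, f 0 ω ∂P) :
    ∃ lam C f, μ ≤ lam ∧ IsCorrector P τ a V β G lam C f ∧ ∫ ω, f 0 ω ∂P ≤ θ ∧
      ∀ lam' C' f', μ ≤ lam' → IsCorrector P τ a V β G lam' C' f' → ∫ ω, f' 0 ω ∂P ≤ θ →
        ∫ ω, f' 0 ω ∂P ≤ ∫ ω, f 0 ω ∂P := by
  set S : Set ℝ := {t | ∃ lam C f, μ ≤ lam ∧ IsCorrector P τ a V β G lam C f ∧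
    ∫ ω, f 0 ω ∂P ≤ θ ∧ ∫ ω, f 0 ω ∂P = t} with hS
  have hSne : S.Nonempty := by
    obtain ⟨lam, C, f, h1, h2, h3⟩ := hlow
    exact ⟨_, lam, C, f, h1, h2, h3, rfl⟩
  have hSbdd : BddAbove S := ⟨θ, by rintro _ ⟨lam, C, f, h1, h2, h3, rfl⟩; exact h3⟩
  obtain ⟨u, humono, hulim, huS⟩ := exists_seq_tendsto_sSup hSne hSbdd
  choose l B F hlμ hF hFθ hFu using huS
  obtain ⟨lg, Cg, g, -, hg, hgθ⟩ := hupp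
  have hFle : ∀ᵐ ω ∂P, ∀ n m, n ≤ m → ∀ x, F n x ω ≤ F m x ω := by
    rw [ae_all_iff]; intro n
    rw [ae_all_iff]; intro m
    by_cases hnm : n ≤ m
    · filter_upwards [(hF n).le_of_mean_le hτ hM hG (hF m)
        ((hFu n).trans_le ((humono hnm).trans_eq (hFu m).symm))] with ω H _ using H
    · exact ae_of_all _ fun _ h => absurd h hnm
  have hFg : ∀ᵐ ω ∂P, ∀ n x, F n x ω ≤ g x ω :=
    ae_all_iff.2 fun n => (hF n).le_of_mean_le hτ hM hG hg ((hFθ n).trans hgθ)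
  -- Every `F n` lies between `F 0` and `g`, which yields one common bound and, through it, bounded
  -- levels.
  set C := max (B 0) Cg with hC
  have hFC : ∀ n, IsCorrector P τ a V β G (l n) C (F n) := fun n => by
    refine IsCorrector.of_between (hF n).toIsStationarySolution
      (m₁ := F 0) (m₂ := g) ?_ ?_ ?_
    · exact ((hF 0).mono (le_max_left _ _)).bound
    · exact (hg.mono (le_max_right _ _)).bound
    · filter_upwards [hFle, hFg] with ω h1 h2 x using ⟨h1 0 n (Nat.zero_le n) x, h2 n x⟩
  obtain ⟨M, hGM⟩ := hG.exists_bound C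
  obtain ⟨lam, hlam, k, hk, hklim⟩ := (isCompact_Icc (a := μ) (b := M + β + 1)).tendsto_subseq
    fun n => ⟨hlμ n, (hFC n).level_le hM hβ hGM⟩
  -- The correctors increase with their means, so they converge along the full sequence; only the
  -- levels need a subsequence.
  set f : ℝ → Ω → ℝ := fun x ω => ⨆ n, F n x ω with hf
  have hfstat : IsStationaryProcess τ f :=
    ⟨Measurable.iSup fun n => (hF n).stat.measurable_uncurry, fun x ω => by
      simp only [hf]; exact iSup_congr fun n => (hF n).stat.stationary x ω⟩
  have hlim : ∀ᵐ ω ∂P, ∀ x, Tendsto (fun n => F n x ω) atTop (𝓝 (f x ω)) := by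
    filter_upwards [hFle, hFg] with ω h1 h2 x
    exact tendsto_atTop_ciSup (fun n m hnm => h1 n m hnm x)
      ⟨g x ω, by rintro _ ⟨n, rfl⟩; exact h2 n x⟩
  have hbd : ∀ᵐ ω ∂P, ∀ n x, |F n x ω| ≤ C := ae_all_iff.2 fun n => (hFC n).bound
  have hsol : ∀ᵐ ω ∂P, ∀ n,
      IsBoundedC1Solution G (fun x => a x ω) (fun x => V x ω) β (l n) fun x => F n x ω :=
    ae_all_iff.2 fun n => (hF n).sol
  have hfcor : IsCorrector P τ a V β G lam C f := by
    refine ⟨⟨hfstat, ?_⟩, ?_⟩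
    · filter_upwards [hlim, hbd, hsol] with ω h1 h2 h3
      exact (hM.coeff ω).isBoundedC1Solution_of_tendsto hG hβ (fun n => h3 (k n))
        (fun n => h2 (k n)) hklim fun x => (h1 x).comp hk.tendsto_atTop
    · filter_upwards [hlim, hbd] with ω h1 h2 x
      exact le_of_tendsto' (h1 x).abs fun n => h2 n x
  have hmean : ∫ ω, f 0 ω ∂P = sSup S := by
    refine tendsto_nhds_unique (tendsto_integral_of_dominated_convergence (fun _ => C)
      (fun n => ((hF n).stat.measurable 0).aestronglyMeasurable) (integrable_const C)
      (fun n => (hFC n).bound.mono fun ω H => H 0) (hlim.mono fun ω H => H 0)) ?_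
    exact hulim.congr fun n => (hFu n).symm
  refine ⟨lam, C, f, hlam.1, hfcor, ?_, fun lam' C' f' h1 h2 h3 => ?_⟩
  · rw [hmean]
    exact csSup_le hSne fun t ⟨_, _, _, _, _, h3, h4⟩ => h4 ▸ h3
  · rw [hmean]
    exact le_csSup hSbdd ⟨lam', C', f', h1, h2, h3, rfl⟩

/-- Among the correctors of level at least `μ` and mean at least `θ` one has the smallest mean. -/
lemma exists_corrector_min_mean [IsProbabilityMeasure P] (hτ : IsErgodicFlow P τ)
    (hM : IsMedium τ a V) (hG : LipOnBounded G) (hβ : 0 < β) {μ θ : ℝ}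
    (hlow : ∃ lam C f, μ ≤ lam ∧ IsCorrector P τ a V β G lam C f ∧ ∫ ω, f 0 ω ∂P ≤ θ)
    (hupp : ∃ lam C f, μ ≤ lam ∧ IsCorrector P τ a V β G lam C f ∧ θ ≤ ∫ ω, f 0 ω ∂P) :
    ∃ lam C f, μ ≤ lam ∧ IsCorrector P τ a V β G lam C f ∧ θ ≤ ∫ ω, f 0 ω ∂P ∧
      ∀ lam' C' f', μ ≤ lam' → IsCorrector P τ a V β G lam' C' f' → θ ≤ ∫ ω, f' 0 ω ∂P →
        ∫ ω, f 0 ω ∂P ≤ ∫ ω, f' 0 ω ∂P := by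
  obtain ⟨l₁, C₁, f₁, h1, h2, h3⟩ := hlow
  obtain ⟨l₂, C₂, f₂, k1, k2, k3⟩ := hupp
  obtain ⟨lam, C, f, e1, e2, e3, e4⟩ := exists_corrector_max_mean hτ.reflect hM.reflect
    hG.comp_neg hβ (μ := μ) (θ := -θ)
    ⟨l₂, C₂, _, k1, k2.reflect, by simpa [integral_neg] using k3⟩
    ⟨l₁, C₁, _, h1, h2.reflect, by simpa [integral_neg] using h3⟩
  have e2' := e2.reflect
  simp only [neg_neg] at e2'
  refine ⟨lam, C, _, e1, e2', ?_, fun lam' C' f' j1 j2 j3 => ?_⟩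
  · simp only [neg_zero, integral_neg]
    linarith
  · have := e4 lam' C' _ j1 j2.reflect (by simpa [integral_neg] using j3)
    simp only [neg_zero, integral_neg] at this ⊢
    linarith

/-- Coercivity in both directions. -/
def IsCoercive (G : ℝ → ℝ) : Prop := ∀ M R : ℝ, ∃ K, R ≤ K ∧ M ≤ G K ∧ M ≤ G (-K)

/-- The constant `θ` is a subsolution at level `G θ + β`, and by coercivity a large constant is a
supersolution at that level. -/
lemma exists_corrector_ge [IsProbabilityMeasure P] (hτ : IsErgodicFlow P τ)
    (hM : IsMedium τ a V) (hG : LipOnBounded G) (hβ : 0 < β) (hco : IsCoercive G) (θ : ℝ) :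
    ∃ C f, IsCorrector P τ a V β G (G θ + β) C f ∧ θ ≤ ∫ ω, f 0 ω ∂P := by
  obtain ⟨K, hK, hGK, -⟩ := hco (G θ + β) |θ|
  obtain ⟨f, hf, hfs, hfb⟩ := hM.exists_between (P := P) (lam := G θ + β) hτ.isFlow hG hβ
    (m₁ := fun _ _ => θ) (isStationaryProcess_const τ K) (C := K)
    (ae_of_all _ fun ω x => hK)
    (ae_of_all _ fun ω x => (abs_of_nonneg ((abs_nonneg θ).trans hK)).le)
    (ae_of_all _ fun ω => (hM.coeff ω).isSub_const hβ le_rfl)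
    (ae_of_all _ fun ω => (hM.coeff ω).isSuper_const hβ hGK)
    (ae_of_all _ fun ω x => (le_abs_self θ).trans hK)
  have hcor : IsCorrector P τ a V β G (G θ + β) K f := IsCorrector.of_between ⟨hf, hfs⟩
    (ae_of_all _ fun ω x => hK)
    (ae_of_all _ fun ω x => (abs_of_nonneg ((abs_nonneg θ).trans hK)).le) hfb
  refine ⟨K, f, hcor, ?_⟩
  have := integral_mono_ae (integrable_const θ) hcor.integrable
    (hfb.mono fun ω H => (H 0).1)
  simpa using this

lemma exists_corrector_le [IsProbabilityMeasure P] (hτ : IsErgodicFlow P τ)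
    (hM : IsMedium τ a V) (hG : LipOnBounded G) (hβ : 0 < β) (hco : IsCoercive G) (θ : ℝ) :
    ∃ C f, IsCorrector P τ a V β G (G θ + β) C f ∧ ∫ ω, f 0 ω ∂P ≤ θ := by
  obtain ⟨C, f, hf, hfθ⟩ := exists_corrector_ge hτ.reflect hM.reflect hG.comp_neg hβ
    (fun M R => by
      obtain ⟨K, h1, h2, h3⟩ := hco M R
      exact ⟨K, h1, h3, by rwa [neg_neg]⟩) (-θ)
  have := hf.reflect
  simp only [neg_neg] at this
  refine ⟨C, _, this, ?_⟩
  simp only [neg_zero, integral_neg]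
  linarith

end

/-! ### Adjacent correctors, their deterministic ranges, and the closing of the gap. -/

section

variable {Ω : Type*} [MeasurableSpace Ω] {P : Measure Ω} {τ : ℝ → Ω → Ω} {a V : ℝ → Ω → ℝ}
  {G : ℝ → ℝ} {β lam lam₁ lam₂ C C₁ C₂ : ℝ} {f g f₁ f₂ : ℝ → Ω → ℝ}

/-- No corrector of level at least `β` lies between `f₁` and `f₂`, apart from these two. -/
def IsAdjacent (P : Measure Ω) (τ : ℝ → Ω → Ω) (a V : ℝ → Ω → ℝ) (β : ℝ) (G : ℝ → ℝ)
    (f₁ f₂ : ℝ → Ω → ℝ) : Prop :=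
  ∀ lam C f, β ≤ lam → IsCorrector P τ a V β G lam C f →
    (∀ᵐ ω ∂P, ∀ x, f₁ x ω ≤ f x ω) → (∀ᵐ ω ∂P, ∀ x, f x ω ≤ f₂ x ω) →
    (∀ᵐ ω ∂P, ∀ x, f₁ x ω = f x ω) ∨ ∀ᵐ ω ∂P, ∀ x, f x ω = f₂ x ω

lemma IsCorrector.level_eq [IsProbabilityMeasure P] (hf : IsCorrector P τ a V β G lam₁ C₁ f)
    (hg : IsCorrector P τ a V β G lam₂ C₂ g) (h : ∀ᵐ ω ∂P, ∀ x, f x ω = g x ω) :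
    lam₁ = lam₂ := by
  obtain ⟨ω, h1, h2, h3⟩ := (hf.sol.and (hg.sol.and h)).exists
  have h4 : (fun x => f x ω) = fun x => g x ω := funext h3
  rw [h4] at h1
  exact (h1.2.2 0).symm.trans (h2.2.2 0)

lemma IsAdjacent.level_mem (h : IsAdjacent P τ a V β G f₁ f₂) [IsProbabilityMeasure P]
    (hf₁ : IsCorrector P τ a V β G lam₁ C₁ f₁) (hf₂ : IsCorrector P τ a V β G lam₂ C₂ f₂)
    (hf : IsCorrector P τ a V β G lam C f) (hl : β ≤ lam)
    (h1 : ∀ᵐ ω ∂P, ∀ x, f₁ x ω ≤ f x ω) (h2 : ∀ᵐ ω ∂P, ∀ x, f x ω ≤ f₂ x ω) :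
    lam = lam₁ ∨ lam = lam₂ := by
  rcases h lam C f hl hf h1 h2 with H | H
  · exact Or.inl (hf₁.level_eq hf H).symm
  · exact Or.inr (hf.level_eq hf₂ H)

/-- With distinct levels the two correctors would be ordered barriers at the mean level, giving a
third corrector between them with a level different from both. -/
lemma IsAdjacent.level_eq (h : IsAdjacent P τ a V β G f₁ f₂) [IsProbabilityMeasure P]
    (hτ : IsErgodicFlow P τ) (hM : IsMedium τ a V) (hG : LipOnBounded G) (hβ : 0 < β)
    (hf₁ : IsCorrector P τ a V β G lam₁ C f₁) (hf₂ : IsCorrector P τ a V β G lam₂ C f₂)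
    (hl₁ : β ≤ lam₁) (hl₂ : β ≤ lam₂) (hle : ∀ᵐ ω ∂P, ∀ x, f₁ x ω ≤ f₂ x ω) :
    lam₁ = lam₂ := by
  rcases lt_trichotomy lam₁ lam₂ with hlt | heq | hlt
  · obtain ⟨f, hf, hfs, hfb⟩ := hM.exists_between (P := P) (lam := (lam₁ + lam₂) / 2) hτ.isFlow
      hG hβ hf₂.stat hf₁.bound hf₂.bound (hf₁.sol.mono fun ω H => H.isSub (by linarith))
      (hf₂.sol.mono fun ω H => H.isSuper (by linarith)) hle
    rcases h.level_mem hf₁ hf₂ (.of_between ⟨hf, hfs⟩ hf₁.bound hf₂.bound hfb) (by linarith)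
      (hfb.mono fun ω H x => (H x).1) (hfb.mono fun ω H x => (H x).2) with H | H <;> linarith
  · exact heq
  · obtain ⟨f, hf, hfs, hfb⟩ := hM.exists_between_of_super_le_sub (P := P)
      (lam := (lam₁ + lam₂) / 2) hτ.isFlow
      hG hβ hf₁.stat hf₁.bound hf₂.bound (hf₁.sol.mono fun ω H => H.isSuper (by linarith))
      (hf₂.sol.mono fun ω H => H.isSub (by linarith)) hle
    rcases h.level_mem hf₁ hf₂ (.of_between ⟨hf, hfs⟩ hf₁.bound hf₂.bound hfb) (by linarith)
      (hfb.mono fun ω H x => (H x).1) (hfb.mono fun ω H x => (H x).2) with H | H <;> linarith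

lemma exists_greatest_ae_lower_bound [IsProbabilityMeasure P]
    (hb : ∀ᵐ ω ∂P, ∀ x, |f x ω| ≤ C) :
    ∃ i, (∀ᵐ ω ∂P, ∀ x, i ≤ f x ω) ∧ ∀ p, (∀ᵐ ω ∂P, ∀ x, p ≤ f x ω) → p ≤ i := by
  set S : Set ℝ := {p | ∀ᵐ ω ∂P, ∀ x, p ≤ f x ω} with hS
  have hne : S.Nonempty := ⟨-C, hb.mono fun ω H x => (abs_le.1 (H x)).1⟩
  have hbdd : BddAbove S := ⟨C, fun p hp => by
    have hp' : ∀ᵐ ω ∂P, ∀ x, p ≤ f x ω := hp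
    obtain ⟨ω, h1, h2⟩ := (hp'.and hb).exists
    exact (h1 0).trans (abs_le.1 (h2 0)).2⟩
  refine ⟨sSup S, ?_, fun p hp => le_csSup hbdd hp⟩
  obtain ⟨u, -, hu, huS⟩ := exists_seq_tendsto_sSup hne hbdd
  filter_upwards [ae_all_iff.2 huS] with ω H x
  exact le_of_tendsto' hu fun n => H n x

lemma exists_least_ae_upper_bound [IsProbabilityMeasure P]
    (hb : ∀ᵐ ω ∂P, ∀ x, |f x ω| ≤ C) :
    ∃ s, (∀ᵐ ω ∂P, ∀ x, f x ω ≤ s) ∧ ∀ p, (∀ᵐ ω ∂P, ∀ x, f x ω ≤ p) → s ≤ p := by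
  obtain ⟨i, h1, h2⟩ := exists_greatest_ae_lower_bound (f := fun x ω => -f x ω) (P := P) (C := C)
    (hb.mono fun ω H x => by rw [abs_neg]; exact H x)
  refine ⟨-i, h1.mono fun ω H x => by linarith [H x], fun p hp => ?_⟩
  linarith [h2 (-p) (hp.mono fun ω H x => neg_le_neg (H x))]

/-- The deterministic range `[i, s]` of a corrector `f` of level `lam`. A constant that is a
subsolution or a supersolution does not lie inside it. -/
structure IsRange (P : Measure Ω) (β : ℝ) (G : ℝ → ℝ) (lam : ℝ) (f : ℝ → Ω → ℝ) (i s : ℝ) :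
    Prop where
  lower : ∀ᵐ ω ∂P, ∀ x, i ≤ f x ω
  upper : ∀ᵐ ω ∂P, ∀ x, f x ω ≤ s
  greatest : ∀ p, (∀ᵐ ω ∂P, ∀ x, p ≤ f x ω) → p ≤ i
  least : ∀ p, (∀ᵐ ω ∂P, ∀ x, f x ω ≤ p) → s ≤ p
  barrier : ∀ p, G p + β ≤ lam ∨ lam ≤ G p → p ≤ i ∨ s ≤ p

/-- The barrier property comes from ergodic ordering against a constant: the constant is an almost
sure lower or upper bound of `f`, so extremality of `i` or `s` applies. -/
lemma IsCorrector.exists_range [IsProbabilityMeasure P] (hτ : IsErgodicFlow P τ)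
    (hM : IsMedium τ a V) (hG : LipOnBounded G) (hβ : 0 < β)
    (hf : IsCorrector P τ a V β G lam C f) : ∃ i s, IsRange P β G lam f i s := by
  obtain ⟨i, hi, hi'⟩ := exists_greatest_ae_lower_bound hf.bound
  obtain ⟨s, hs, hs'⟩ := exists_least_ae_upper_bound hf.bound
  refine ⟨i, s, hi, hs, hi', hs', fun p hp => ?_⟩
  have hfb : ∀ᵐ ω ∂P, ∃ C, ∀ x, |f x ω| ≤ C := hf.bound.mono fun ω H => ⟨C, H⟩
  have hpb : ∀ᵐ ω ∂P, ∃ C, ∀ _x : ℝ, |p| ≤ C := ae_of_all _ fun _ => ⟨|p|, fun _ => le_rfl⟩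
  rcases hp with hp | hp
  · rcases order_of_sub_super hτ hM hG (isStationaryProcess_const τ p) hf.stat
      (ae_of_all _ fun ω => (hM.coeff ω).isSub_const hβ hp)
      (hf.sol.mono fun ω H => H.isSuper le_rfl) hpb hfb with h | h
    · exact Or.inl (hi' p h)
    · exact Or.inr (hs' p (h.mono fun ω H x => (H x).le))
  · rcases order_of_sub_super hτ hM hG hf.stat (isStationaryProcess_const τ p)
      (hf.sol.mono fun ω H => H.isSub le_rfl)
      (ae_of_all _ fun ω => (hM.coeff ω).isSuper_const hβ hp) hfb hpb with h | h
    · exact Or.inr (hs' p h)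
    · exact Or.inl (hi' p (h.mono fun ω H x => (H x).le))

lemma IsRange.mem_Icc_of_mem_Ioo {i s : ℝ} (h : IsRange P β G lam f i s) {p : ℝ}
    (hp : p ∈ Ioo i s) : G p ∈ Icc (lam - β) lam := by
  constructor <;> by_contra! hn
  · rcases h.barrier p (Or.inl (by linarith)) with H | H
    · exact absurd hp.1 (not_lt.2 H)
    · exact absurd hp.2 (not_lt.2 H)
  · rcases h.barrier p (Or.inr hn.le) with H | H
    · exact absurd hp.1 (not_lt.2 H)
    · exact absurd hp.2 (not_lt.2 H)

lemma IsCorrector.ae_mem_Icc (hM : IsMedium τ a V) (hG : LipOnBounded G) (hβ : 0 < β)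
    (hf : IsCorrector P τ a V β G lam C f) {i s : ℝ} (h : IsRange P β G lam f i s) :
    ∀ᵐ ω ∂P, ∀ x, G (f x ω) ∈ Icc (lam - β) lam := by
  -- A degenerate range has no interior to take the closure of, but then `f` is constant and the
  -- equation itself gives the bounds.
  rcases eq_or_ne i s with his | his
  · filter_upwards [h.lower, h.upper, hf.sol] with ω h1 h2 h3 x
    have hc : (fun x => f x ω) = fun _ => i := funext fun y =>
      le_antisymm ((h2 y).trans_eq his.symm) (h1 y)
    have h4 := h3.2.2 x
    simp only [hc, deriv_const, mul_zero, zero_add] at h4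
    have h5 := mul_nonneg hβ.le ((hM.coeff ω).v_nonneg x)
    have h6 := mul_le_mul_of_nonneg_left ((hM.coeff ω).v_le_one x) hβ.le
    constructor <;> linarith
  · have hsub : Icc i s ⊆ G ⁻¹' Icc (lam - β) lam := by
      rw [← closure_Ioo his]
      exact closure_minimal (fun p hp => h.mem_Icc_of_mem_Ioo hp)
        (isClosed_Icc.preimage hG.continuous)
    filter_upwards [h.lower, h.upper] with ω h1 h2 x using hsub ⟨h1 x, h2 x⟩

/-- Averaging over a long hill: at some point of it both solutions are near the bottom of the
range of levels. -/
lemma IsCoeff.exists_low_on_hill {a v f₁ f₂ : ℝ → ℝ} (hco : IsCoeff a v) (hβ : 0 < β)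
    (h₁ : IsBoundedC1Solution G a v β lam f₁) (h₂ : IsBoundedC1Solution G a v β lam f₂)
    (hC₁ : ∀ x, |f₁ x| ≤ C) (hC₂ : ∀ x, |f₂ x| ≤ C) {η h y : ℝ}
    (hh : 4 * β * (1 - h) ≤ η) (hy : 8 * C < η * y) {l₁ l₂ : ℝ} (hl : l₁ < l₂)
    (hint : ∫ x in l₁..l₂, 1 / a x = y) (hhill : ∀ x ∈ Icc l₁ l₂, h ≤ v x) :
    ∃ x, G (f₁ x) + G (f₂ x) ≤ 2 * (lam - β) + η := by
  by_contra! hn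
  have hd₁ := h₁.1.differentiable one_ne_zero
  have hd₂ := h₂.1.differentiable one_ne_zero
  have hder : ∀ x, HasDerivAt (fun x => f₁ x + f₂ x + η / 2 * clock a x)
      (deriv f₁ x + deriv f₂ x + η / 2 * (1 / a x)) x := fun x =>
    ((hd₁ x).hasDerivAt.add (hd₂ x).hasDerivAt).add ((hco.hasDerivAt_clock x).const_mul _)
  -- Adding the two equations gives `a (f₁ + f₂)' ≤ -η / 2` on the hill, a drop of `η * y / 2 > 4 *
  -- C` over clock length `y`. The sum is used so that both solutions are controlled at the same
  -- point.
  have hanti : AntitoneOn (fun x => f₁ x + f₂ x + η / 2 * clock a x) (Icc l₁ l₂) := by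
    refine antitoneOn_of_hasDerivWithinAt_nonpos (convex_Icc _ _)
      (fun y _ => (hder y).continuousAt.continuousWithinAt)
      (fun y _ => (hder y).hasDerivWithinAt) fun x hx => ?_
    have ha := hco.pos x
    have e1 := h₁.2.2 x
    have e2 := h₂.2.2 x
    have e3 := mul_le_mul_of_nonneg_left (hhill x (interior_subset hx)) hβ.le
    have e4 := hn x
    have : a x * (deriv f₁ x + deriv f₂ x + η / 2 * (1 / a x)) ≤ 0 := by
      have : a x * (η / 2 * (1 / a x)) = η / 2 := by field_simp
      rw [mul_add, this]
      linarith
    exact nonpos_of_mul_nonpos_right this ha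
  have := hanti (left_mem_Icc.2 hl.le) (right_mem_Icc.2 hl.le) hl.le
  rw [hco.clock_eq_integral] at hint
  simp only at this
  have b1 := abs_le.1 (hC₁ l₁)
  have b2 := abs_le.1 (hC₂ l₁)
  have b3 := abs_le.1 (hC₁ l₂)
  have b4 := abs_le.1 (hC₂ l₂)
  rw [← hint] at hy
  linarith

/-- Averaging over a long valley: at some point of it both solutions are near the top of the
range of levels. -/
lemma IsCoeff.exists_high_on_valley {a v f₁ f₂ : ℝ → ℝ} (hco : IsCoeff a v) (hβ : 0 < β)
    (h₁ : IsBoundedC1Solution G a v β lam f₁) (h₂ : IsBoundedC1Solution G a v β lam f₂)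
    (hC₁ : ∀ x, |f₁ x| ≤ C) (hC₂ : ∀ x, |f₂ x| ≤ C) {η h y : ℝ}
    (hh : 4 * β * h ≤ η) (hy : 8 * C < η * y) {l₁ l₂ : ℝ} (hl : l₁ < l₂)
    (hint : ∫ x in l₁..l₂, 1 / a x = y) (hvalley : ∀ x ∈ Icc l₁ l₂, v x ≤ h) :
    ∃ x, 2 * lam - η ≤ G (f₁ x) + G (f₂ x) := by
  by_contra! hn
  have hd₁ := h₁.1.differentiable one_ne_zero
  have hd₂ := h₂.1.differentiable one_ne_zero
  have hder : ∀ x, HasDerivAt (fun x => f₁ x + f₂ x - η / 2 * clock a x)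
      (deriv f₁ x + deriv f₂ x - η / 2 * (1 / a x)) x := fun x =>
    ((hd₁ x).hasDerivAt.add (hd₂ x).hasDerivAt).sub ((hco.hasDerivAt_clock x).const_mul _)
  have hmono : MonotoneOn (fun x => f₁ x + f₂ x - η / 2 * clock a x) (Icc l₁ l₂) := by
    refine monotoneOn_of_hasDerivWithinAt_nonneg (convex_Icc _ _)
      (fun y _ => (hder y).continuousAt.continuousWithinAt)
      (fun y _ => (hder y).hasDerivWithinAt) fun x hx => ?_
    have ha := hco.pos x
    have e1 := h₁.2.2 x
    have e2 := h₂.2.2 x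
    have e3 := mul_le_mul_of_nonneg_left (hvalley x (interior_subset hx)) hβ.le
    have e4 := hn x
    have : 0 ≤ a x * (deriv f₁ x + deriv f₂ x - η / 2 * (1 / a x)) := by
      have : a x * (η / 2 * (1 / a x)) = η / 2 := by field_simp
      rw [mul_sub, this]
      linarith
    exact nonneg_of_mul_nonneg_right this ha
  have := hmono (left_mem_Icc.2 hl.le) (right_mem_Icc.2 hl.le) hl.le
  rw [hco.clock_eq_integral] at hint
  simp only at this
  have b1 := abs_le.1 (hC₁ l₁)
  have b2 := abs_le.1 (hC₂ l₁)
  have b3 := abs_le.1 (hC₁ l₂)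
  have b4 := abs_le.1 (hC₂ l₂)
  rw [← hint] at hy
  linarith

/-- Here `t` is the allowed deviation of `V` from `1` on a hill or from `0` on a valley, and `y` is
the clock length. -/
lemma exists_hill_parameters (hβ : 0 < β) (C : ℝ) {η : ℝ} (hη : 0 < η) :
    ∃ t y : ℝ, 0 < t ∧ t < 1 ∧ 4 * β * t ≤ η ∧ 0 < y ∧ 8 * C < η * y := by
  refine ⟨min (1 / 2) (η / (4 * β)), 8 * |C| / η + 1, by positivity,
    (min_le_left _ _).trans_lt (by norm_num), ?_, by positivity, ?_⟩
  · have := min_le_right (1 / 2) (η / (4 * β))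
    rwa [le_div_iff₀ (by positivity), mul_comm] at this
  · have : η * (8 * |C| / η + 1) = 8 * |C| + η := by field_simp
    rw [this]
    have := le_abs_self C
    linarith

lemma ae_exists_low [IsProbabilityMeasure P] (hM : IsMedium τ a V) (hβ : 0 < β)
    (hhill : ScaledHill P a V) (hf₁ : IsCorrector P τ a V β G lam C f₁)
    (hf₂ : IsCorrector P τ a V β G lam C f₂) {η : ℝ} (hη : 0 < η) :
    ∀ᵐ ω ∂P, ∃ x, G (f₁ x ω) + G (f₂ x ω) ≤ 2 * (lam - β) + η := by
  obtain ⟨t, y, ht0, ht1, htη, hy0, hy⟩ := exists_hill_parameters hβ C hη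
  filter_upwards [hhill (1 - t) (by linarith) (by linarith) y hy0, hf₁.sol, hf₂.sol, hf₁.bound,
    hf₂.bound] with ω ⟨l₁, l₂, hl, hint, hV⟩ h1 h2 h3 h4
  exact (hM.coeff ω).exists_low_on_hill hβ h1 h2 h3 h4 (by linarith) hy hl hint hV

lemma ae_exists_high [IsProbabilityMeasure P] (hM : IsMedium τ a V) (hβ : 0 < β)
    (hvalley : ScaledValley P a V) (hf₁ : IsCorrector P τ a V β G lam C f₁)
    (hf₂ : IsCorrector P τ a V β G lam C f₂) {η : ℝ} (hη : 0 < η) :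
    ∀ᵐ ω ∂P, ∃ x, 2 * lam - η ≤ G (f₁ x ω) + G (f₂ x ω) := by
  obtain ⟨t, y, ht0, ht1, htη, hy0, hy⟩ := exists_hill_parameters hβ C hη
  filter_upwards [hvalley t ht0 ht1 y hy0, hf₁.sol, hf₂.sol, hf₁.bound,
    hf₂.bound] with ω ⟨l₁, l₂, hl, hint, hV⟩ h1 h2 h3 h4
  exact (hM.coeff ω).exists_high_on_valley hβ h1 h2 h3 h4 htη hy hl hint hV

/-- Compactness turns approximate roots at common points into exact ones; the uniform gap survives
in the limit and keeps them distinct. -/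
lemma exists_limit_pair (hG : Continuous G) {u w : ℝ → ℝ} {i₁ s₁ i₂ s₂ ε c : ℝ}
    (hu : ∀ x, u x ∈ Icc i₁ s₁) (hw : ∀ x, w x ∈ Icc i₂ s₂) (hε : 0 < ε)
    (hgap : ∀ x, ε ≤ w x - u x)
    (hc : ∀ n : ℕ, ∃ x, |G (u x) - c| ≤ 1 / ((n : ℝ) + 1) ∧ |G (w x) - c| ≤ 1 / ((n : ℝ) + 1)) :
    ∃ p ∈ Icc i₁ s₁, ∃ q ∈ Icc i₂ s₂, p < q ∧ G p = c ∧ G q = c := by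
  choose x hx1 hx2 using hc
  obtain ⟨⟨p, q⟩, hpq, k, hk, hlim⟩ := (isCompact_Icc.prod isCompact_Icc).tendsto_subseq
    (x := fun n => (u (x n), w (x n))) fun n => mk_mem_prod (hu (x n)) (hw (x n))
  have h1 : Tendsto (fun n => u (x (k n))) atTop (𝓝 p) := (continuous_fst.tendsto _).comp hlim
  have h2 : Tendsto (fun n => w (x (k n))) atTop (𝓝 q) := (continuous_snd.tendsto _).comp hlim
  have hz : Tendsto (fun n => 1 / ((k n : ℝ) + 1)) atTop (𝓝 0) :=
    tendsto_one_div_add_atTop_nhds_zero_nat.comp hk.tendsto_atTop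
  have hval : ∀ {z : ℕ → ℝ} {l : ℝ}, Tendsto z atTop (𝓝 l) →
      (∀ n, |G (z n) - c| ≤ 1 / ((k n : ℝ) + 1)) → G l = c := fun {z l} hzl hb => by
    have h3 : Tendsto (fun n => |G (z n) - c|) atTop (𝓝 |G l - c|) :=
      (((hG.tendsto l).comp hzl).sub_const c).abs
    have h4 := le_of_tendsto_of_tendsto' h3 hz hb
    exact sub_eq_zero.1 (abs_nonpos_iff.1 h4)
  refine ⟨p, hpq.1, q, hpq.2, ?_, hval h1 fun n => hx1 (k n), hval h2 fun n => hx2 (k n)⟩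
  have : ε ≤ q - p := ge_of_tendsto' (h2.sub h1) fun n => hgap _
  linarith

/-- Two solutions that stay apart determine deterministic ranges whose end points are roots of
`G = lam - β` and of `G = lam`. -/
lemma exists_roots_of_gap [IsProbabilityMeasure P] (hM : IsMedium τ a V) (hG : LipOnBounded G)
    (hβ : 0 < β) (hhill : ScaledHill P a V) (hvalley : ScaledValley P a V)
    (hf₁ : IsCorrector P τ a V β G lam C f₁) (hf₂ : IsCorrector P τ a V β G lam C f₂)
    {i₁ s₁ i₂ s₂ : ℝ} (h₁ : IsRange P β G lam f₁ i₁ s₁) (h₂ : IsRange P β G lam f₂ i₂ s₂)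
    {ε : ℝ} (hε : 0 < ε) (hgap : ¬ ∀ᵐ ω ∂P, ∃ x, f₂ x ω - f₁ x ω < ε) :
    (∃ q₁ ∈ Icc i₁ s₁, ∃ q₂ ∈ Icc i₂ s₂, q₁ < q₂ ∧ G q₁ = lam - β ∧ G q₂ = lam - β) ∧
      ∃ r₁ ∈ Icc i₁ s₁, ∃ r₂ ∈ Icc i₂ s₂, r₁ < r₂ ∧ G r₁ = lam ∧ G r₂ = lam := by
  have hlow : ∀ᵐ ω ∂P, ∀ n : ℕ, ∃ x,
      G (f₁ x ω) + G (f₂ x ω) ≤ 2 * (lam - β) + 1 / ((n : ℝ) + 1) :=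
    ae_all_iff.2 fun n => ae_exists_low hM hβ hhill hf₁ hf₂ (by positivity)
  have hhigh : ∀ᵐ ω ∂P, ∀ n : ℕ, ∃ x,
      2 * lam - 1 / ((n : ℝ) + 1) ≤ G (f₁ x ω) + G (f₂ x ω) :=
    ae_all_iff.2 fun n => ae_exists_high hM hβ hvalley hf₁ hf₂ (by positivity)
  rw [not_eventually] at hgap
  obtain ⟨ω, hω, h1, h2, h3, h4, h5, h6, h7, h8⟩ := (hgap.and_eventually (hlow.and (hhigh.and
    ((hf₁.ae_mem_Icc hM hG hβ h₁).and ((hf₂.ae_mem_Icc hM hG hβ h₂).and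
      (h₁.lower.and (h₁.upper.and (h₂.lower.and h₂.upper)))))))).exists
  push Not at hω
  constructor
  · refine exists_limit_pair hG.continuous (fun x => ⟨h5 x, h6 x⟩) (fun x => ⟨h7 x, h8 x⟩) hε hω
      fun n => ?_
    obtain ⟨x, hx⟩ := h1 n
    -- Each value is at least `lam - β`, so the bound on the sum controls each of them.
    have e1 := (h3 x).1
    have e2 := (h4 x).1
    refine ⟨x, abs_le.2 ⟨?_, ?_⟩, abs_le.2 ⟨?_, ?_⟩⟩ <;>
      linarith [show (0:ℝ) ≤ 1 / ((n : ℝ) + 1) by positivity]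
  · refine exists_limit_pair hG.continuous (fun x => ⟨h5 x, h6 x⟩) (fun x => ⟨h7 x, h8 x⟩) hε hω
      fun n => ?_
    obtain ⟨x, hx⟩ := h2 n
    have e1 := (h3 x).2
    have e2 := (h4 x).2
    refine ⟨x, abs_le.2 ⟨?_, ?_⟩, abs_le.2 ⟨?_, ?_⟩⟩ <;>
      linarith [show (0:ℝ) ≤ 1 / ((n : ℝ) + 1) by positivity]

section Adjacent

variable {i₁ s₁ i₂ s₂ : ℝ}

/-- Constants between two adjacent correctors are not strict barriers. -/
lemma IsAdjacent.mem_Icc_of_between (h : IsAdjacent P τ a V β G f₁ f₂) [IsProbabilityMeasure P]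
    (hτ : IsErgodicFlow P τ) (hM : IsMedium τ a V) (hG : LipOnBounded G) (hβ : 0 < β)
    (hG0 : ∀ p, 0 ≤ G p) (hl : β ≤ lam)
    (hf₁ : IsCorrector P τ a V β G lam C f₁) (hf₂ : IsCorrector P τ a V β G lam C f₂)
    (h₁ : IsRange P β G lam f₁ i₁ s₁) (h₂ : IsRange P β G lam f₂ i₂ s₂) {p : ℝ}
    (hp : p ∈ Icc s₁ i₂) : G p ∈ Icc (lam - β) lam := by
  have hpf₂ : ∀ᵐ ω ∂P, ∀ x, p ≤ f₂ x ω := h₂.lower.mono fun ω H x => hp.2.trans (H x)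
  have hf₁p : ∀ᵐ ω ∂P, ∀ x, f₁ x ω ≤ p := h₁.upper.mono fun ω H x => (H x).trans hp.1
  have hpb : ∀ᵐ ω ∂P, ∀ _x : ℝ, |p| ≤ C := by
    filter_upwards [hpf₂, hf₁p, hf₁.bound, hf₂.bound] with ω e1 e2 e3 e4 _
    exact abs_le.2 ⟨(abs_le.1 (e3 0)).1.trans (e2 0), (e1 0).trans (abs_le.1 (e4 0)).2⟩
  constructor <;> by_contra! hn
  -- Otherwise `p` is a barrier at the level `G p + β < lam`, and a corrector of that level fits
  -- between `p` and `f₂`. Nonnegativity of `G` keeps the level admissible.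
  · obtain ⟨f, hf, hfs, hfb⟩ := hM.exists_between (P := P) (lam := G p + β) hτ.isFlow
      hG hβ hf₂.stat hpb hf₂.bound (ae_of_all _ fun ω => (hM.coeff ω).isSub_const hβ le_rfl)
      (hf₂.sol.mono fun ω H => H.isSuper (by linarith)) hpf₂
    rcases h.level_mem hf₁ hf₂ (.of_between ⟨hf, hfs⟩ hpb hf₂.bound hfb)
      (by linarith [hG0 p])
      ((hf₁p.and hfb).mono fun ω H x => (H.1 x).trans (H.2 x).1)
      (hfb.mono fun ω H x => (H x).2) with H | H <;> linarith
  · obtain ⟨f, hf, hfs, hfb⟩ := hM.exists_between_of_super_le_sub (P := P) (lam := G p) hτ.isFlow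
      hG hβ (isStationaryProcess_const τ p) hpb hf₂.bound
      (ae_of_all _ fun ω => (hM.coeff ω).isSuper_const hβ le_rfl)
      (hf₂.sol.mono fun ω H => H.isSub hn.le) hpf₂
    rcases h.level_mem hf₁ hf₂ (.of_between ⟨hf, hfs⟩ hpb hf₂.bound hfb)
      (by linarith)
      ((hf₁p.and hfb).mono fun ω H x => (H.1 x).trans (H.2 x).1)
      (hfb.mono fun ω H x => (H x).2) with H | H <;> linarith

/-- Equality with `f₁` or with `f₂` would collapse the corresponding range to a point. -/
lemma IsAdjacent.false_of_corrector_between (h : IsAdjacent P τ a V β G f₁ f₂)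
    (hl : β ≤ lam) (h₁ : IsRange P β G lam f₁ i₁ s₁) (h₂ : IsRange P β G lam f₂ i₂ s₂)
    (hi₁ : i₁ < s₁) (hi₂ : i₂ < s₂) (hf : IsCorrector P τ a V β G lam C f)
    (hfb : ∀ᵐ ω ∂P, ∀ x, s₁ ≤ f x ω ∧ f x ω ≤ i₂) : False := by
  rcases h lam C f hl hf
    (by filter_upwards [h₁.upper, hfb] with ω e1 e2 x using (e1 x).trans (e2 x).1)
    (by filter_upwards [h₂.lower, hfb] with ω e1 e2 x using (e2 x).2.trans (e1 x)) with H | H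
  · refine absurd (h₁.greatest s₁ ?_) (not_le.2 hi₁)
    filter_upwards [H, hfb] with ω e1 e2 x
    rw [e1 x]
    exact (e2 x).1
  · refine absurd (h₂.least i₂ ?_) (not_le.2 hi₂)
    filter_upwards [H, hfb] with ω e1 e2 x
    rw [← e1 x]
    exact (e2 x).2

/-- Adjacent correctors of the same level come arbitrarily close to each other. -/
lemma IsAdjacent.ae_exists_sub_lt (h : IsAdjacent P τ a V β G f₁ f₂) [IsProbabilityMeasure P]
    (hτ : IsErgodicFlow P τ) (hM : IsMedium τ a V) (hG : LipOnBounded G) (hβ : 0 < β)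
    (hG0 : ∀ p, 0 ≤ G p) (hinj : InjOn G {p | IsLocalExtr G p})
    (hhill : ScaledHill P a V) (hvalley : ScaledValley P a V) (hl : β ≤ lam)
    (hf₁ : IsCorrector P τ a V β G lam C f₁) (hf₂ : IsCorrector P τ a V β G lam C f₂)
    {ε : ℝ} (hε : 0 < ε) : ∀ᵐ ω ∂P, ∃ x, f₂ x ω - f₁ x ω < ε := by
  obtain ⟨i₁, s₁, h₁⟩ := hf₁.exists_range hτ hM hG hβ
  obtain ⟨i₂, s₂, h₂⟩ := hf₂.exists_range hτ hM hG hβ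
  by_contra hgap
  obtain ⟨⟨q₁, hq₁, q₂, hq₂, hq, hGq₁, hGq₂⟩, r₁, hr₁, r₂, hr₂, hr, hGr₁, hGr₂⟩ :=
    exists_roots_of_gap hM hG hβ hhill hvalley hf₁ hf₂ h₁ h₂ hε hgap
  have hne₁ : q₁ ≠ r₁ := fun e => by rw [e] at hGq₁; linarith
  have hne₂ : q₂ ≠ r₂ := fun e => by rw [e] at hGq₂; linarith
  -- Roots of `G = lam - β` and of `G = lam` are constant barriers, so each sits at an end point;
  -- being distinct, they occupy both.
  have hends : ∀ {i s q r : ℝ} {f : ℝ → Ω → ℝ}, IsRange P β G lam f i s → q ∈ Icc i s →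
      r ∈ Icc i s → q ≠ r → G q = lam - β → G r = lam →
      (q = i ∧ r = s ∧ i < s) ∨ (q = s ∧ r = i ∧ i < s) := by
    intro i s q r f hR hq hr hne hGq hGr
    have e1 : q = i ∨ q = s := (hR.barrier q (Or.inl (by linarith))).imp
      (fun H => le_antisymm H hq.1) (fun H => le_antisymm hq.2 H)
    have e2 : r = i ∨ r = s := (hR.barrier r (Or.inr hGr.ge)).imp
      (fun H => le_antisymm H hr.1) (fun H => le_antisymm hr.2 H)
    have his : i ≤ s := hq.1.trans hq.2
    rcases e1 with e1 | e1 <;> rcases e2 with e2 | e2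
    · exact absurd (e1.trans e2.symm) hne
    · exact Or.inl ⟨e1, e2, lt_of_le_of_ne his fun e => hne (by rw [e1, e2, e])⟩
    · exact Or.inr ⟨e1, e2, lt_of_le_of_ne his fun e => hne (by rw [e1, e2, e])⟩
    · exact absurd (e1.trans e2.symm) hne
  -- on the open interval spanned by both ranges `G` takes values in `[lam - β, lam]`
  have hmid : ∀ p ∈ Ioo i₁ s₂, G p ∈ Icc (lam - β) lam := by
    intro p hp
    by_cases c1 : p < s₁
    · exact h₁.mem_Icc_of_mem_Ioo ⟨hp.1, c1⟩
    by_cases c2 : i₂ < p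
    · exact h₂.mem_Icc_of_mem_Ioo ⟨c2, hp.2⟩
    exact h.mem_Icc_of_between hτ hM hG hβ hG0 hl hf₁ hf₂ h₁ h₂ ⟨not_lt.1 c1, not_lt.1 c2⟩
  have hcb : ∀ p ∈ Icc i₁ s₂, s₁ ≤ i₂ → (p = s₁ ∨ p = i₂) → ∀ᵐ ω ∂P, ∀ _x : ℝ, |p| ≤ C := by
    intro p hp hle hor
    filter_upwards [hf₁.bound, hf₂.bound, h₁.upper, h₂.lower] with ω e1 e2 e3 e4 _
    have := abs_le.1 (e1 0)
    have := abs_le.1 (e2 0)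
    have := e3 0
    have := e4 0
    rcases hor with rfl | rfl <;> exact abs_le.2 ⟨by linarith, by linarith⟩
  -- Equal orientations leave a sub- and a supersolution facing each other across the middle;
  -- opposite ones produce two maxima of height `lam` or two minima of height `lam - β`.
  rcases hends h₁ hq₁ hr₁ hne₁ hGq₁ hGr₁ with ⟨a1, b1, c1⟩ | ⟨a1, b1, c1⟩ <;>
    rcases hends h₂ hq₂ hr₂ hne₂ hGq₂ hGr₂ with ⟨a2, b2, c2⟩ | ⟨a2, b2, c2⟩ <;>
    subst a1 b1 a2 b2
  · have hle : r₁ ≤ q₂ := (h₂.barrier r₁ (Or.inr hGr₁.ge)).resolve_right (not_le.2 hr)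
    obtain ⟨f, hf, hfs, hfb⟩ := hM.exists_between_of_super_le_sub (P := P) (lam := lam) hτ.isFlow
      hG hβ (m₂ := fun _ _ => q₂) (isStationaryProcess_const τ r₁)
      (hcb r₁ ⟨c1.le, hr.le⟩ hle (Or.inl rfl)) (hcb q₂ ⟨hq.le, c2.le⟩ hle (Or.inr rfl))
      (ae_of_all _ fun ω => (hM.coeff ω).isSuper_const hβ hGr₁.ge)
      (ae_of_all _ fun ω => (hM.coeff ω).isSub_const hβ (by linarith))
      (ae_of_all _ fun _ _ => hle)
    exact h.false_of_corrector_between hl h₁ h₂ c1 c2 (.of_between ⟨hf, hfs⟩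
      (hcb r₁ ⟨c1.le, hr.le⟩ hle (Or.inl rfl)) (hcb q₂ ⟨hq.le, c2.le⟩ hle (Or.inr rfl)) hfb) hfb
  · have hmax : ∀ r ∈ Ioo q₁ q₂, G r = lam → IsLocalExtr G r := fun r hr hGr => Or.inr <| by
      filter_upwards [Ioo_mem_nhds hr.1 hr.2] with p hp
      exact (hmid p hp).2.trans_eq hGr.symm
    exact hr.ne (hinj (hmax r₁ ⟨c1, hr.trans c2⟩ hGr₁) (hmax r₂ ⟨c1.trans hr, c2⟩ hGr₂)
      (hGr₁.trans hGr₂.symm))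
  · have hmin : ∀ q ∈ Ioo r₁ r₂, G q = lam - β → IsLocalExtr G q := fun q hq hGq => Or.inl <| by
      filter_upwards [Ioo_mem_nhds hq.1 hq.2] with p hp
      exact hGq.trans_le (hmid p hp).1
    exact hq.ne (hinj (hmin q₁ ⟨c1, hq.trans c2⟩ hGq₁) (hmin q₂ ⟨c1.trans hq, c2⟩ hGq₂)
      (hGq₁.trans hGq₂.symm))
  · have hle : q₁ ≤ r₂ := (h₂.barrier q₁ (Or.inl (by linarith))).resolve_right (not_le.2 hq)
    obtain ⟨f, hf, hfs, hfb⟩ := hM.exists_between (P := P) (lam := lam) hτ.isFlow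
      hG hβ (m₁ := fun _ _ => q₁) (isStationaryProcess_const τ r₂)
      (hcb q₁ ⟨c1.le, hq.le⟩ hle (Or.inl rfl)) (hcb r₂ ⟨hr.le, c2.le⟩ hle (Or.inr rfl))
      (ae_of_all _ fun ω => (hM.coeff ω).isSub_const hβ (by linarith))
      (ae_of_all _ fun ω => (hM.coeff ω).isSuper_const hβ hGr₂.ge)
      (ae_of_all _ fun _ _ => hle)
    exact h.false_of_corrector_between hl h₁ h₂ c1 c2 (.of_between ⟨hf, hfs⟩
      (hcb q₁ ⟨c1.le, hq.le⟩ hle (Or.inl rfl)) (hcb r₂ ⟨hr.le, c2.le⟩ hle (Or.inr rfl)) hfb) hfb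

end Adjacent

/-- Existence of a corrector pair at every slope. -/
lemma exists_correctorPair [IsProbabilityMeasure P] (hτ : IsErgodicFlow P τ)
    (hM : IsMedium τ a V) (hG : LipOnBounded G) (hco : IsCoercive G) (hβ : 0 < β)
    (hG0 : ∀ p, 0 ≤ G p) (hinj : InjOn G {p | IsLocalExtr G p})
    (hhill : ScaledHill P a V) (hvalley : ScaledValley P a V) (θ : ℝ) :
    ∃ lam, β ≤ lam ∧ ∃ f₁ f₂, IsCorrectorPair P τ a V β G θ lam f₁ f₂ := by
  have hlow : ∃ lam C f, β ≤ lam ∧ IsCorrector P τ a V β G lam C f ∧ ∫ ω, f 0 ω ∂P ≤ θ := by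
    obtain ⟨C, f, h1, h2⟩ := exists_corrector_le hτ hM hG hβ hco θ
    exact ⟨_, C, f, by linarith [hG0 θ], h1, h2⟩
  have hupp : ∃ lam C f, β ≤ lam ∧ IsCorrector P τ a V β G lam C f ∧ θ ≤ ∫ ω, f 0 ω ∂P := by
    obtain ⟨C, f, h1, h2⟩ := exists_corrector_ge hτ hM hG hβ hco θ
    exact ⟨_, C, f, by linarith [hG0 θ], h1, h2⟩
  obtain ⟨l₁, C₁, f₁, hl₁, hf₁, hθ₁, hmax⟩ := exists_corrector_max_mean hτ hM hG hβ hlow hupp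
  obtain ⟨l₂, C₂, f₂, hl₂, hf₂, hθ₂, hmin⟩ := exists_corrector_min_mean hτ hM hG hβ hlow hupp
  have hle := hf₁.le_of_mean_le hτ hM hG hf₂ (hθ₁.trans hθ₂)
  replace hf₁ := hf₁.mono (le_max_left C₁ C₂)
  replace hf₂ := hf₂.mono (le_max_right C₁ C₂)
  -- A corrector in between has its mean on one side of `θ`; extremality forces it to equal the mean
  -- of `f₁` or of `f₂`, and ordered correctors with equal means coincide.
  have hadj : IsAdjacent P τ a V β G f₁ f₂ := fun l C f hl hf h1 h2 => by
    rcases le_total (∫ ω, f 0 ω ∂P) θ with hm | hm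
    · exact Or.inl (hf₁.eq_of_mean_eq hτ hf h1 (le_antisymm
        (integral_mono_ae hf₁.integrable hf.integrable (h1.mono fun ω H => H 0))
        (hmax l C f hl hf hm)))
    · exact Or.inr (hf.eq_of_mean_eq hτ hf₂ h2 (le_antisymm
        (integral_mono_ae hf.integrable hf₂.integrable (h2.mono fun ω H => H 0))
        (hmin l C f hl hf hm)))
  obtain rfl := hadj.level_eq hτ hM hG hβ hf₁ hf₂ hl₁ hl₂ hle
  refine ⟨l₁, hl₁, f₁, f₂, hf₁.stat, hf₂.stat, hf₁.sol, hf₂.sol, ?_, hf₁.integrable,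
    hf₂.integrable, hθ₁, hθ₂⟩
  have hclose : ∀ᵐ ω ∂P, ∀ n : ℕ, ∃ x, f₂ x ω - f₁ x ω < 1 / ((n : ℝ) + 1) :=
    ae_all_iff.2 fun n => hadj.ae_exists_sub_lt hτ hM hG hβ hG0 hinj hhill hvalley hl₁ hf₁ hf₂
      (by positivity)
  filter_upwards [hle, hclose] with ω h1 h2
  refine ⟨by rintro _ ⟨x, rfl⟩; exact sub_nonneg.2 (h1 x), fun b hb => ?_⟩
  by_contra! hb0
  obtain ⟨n, hn⟩ := exists_nat_one_div_lt hb0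
  obtain ⟨x, hx⟩ := h2 n
  have := hb ⟨x, rfl⟩
  simp only at this
  linarith

/-! ### Properties of the classes of nonlinearities, and the theorem. -/

lemma ClassG.lipOnBounded (h : G ∈ ClassG) : LipOnBounded G := by
  obtain ⟨α₀, α₁, γ, h0, h1, hγ, -, hLip⟩ := h
  intro C
  have hb : 0 < 2 * |C| + 1 := by positivity
  refine ⟨α₁ * (2 * |C| + 1) ^ (γ - 1), mul_pos h1 (Real.rpow_pos_of_pos hb _),
    fun p q hp hq => (hLip p q).trans ?_⟩
  have := le_abs_self C
  gcongr
  linarith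

lemma ClassG.isCoercive (h : G ∈ ClassG) : IsCoercive G := by
  obtain ⟨α₀, α₁, γ, h0, h1, hγ, hgrowth, -⟩ := h
  intro M R
  have ht : Tendsto (fun K : ℝ => α₀ * K ^ γ - 1 / α₀) atTop atTop :=
    tendsto_atTop_add_const_right _ _
      ((tendsto_rpow_atTop (by linarith)).const_mul_atTop h0)
  obtain ⟨K, hK1, hK2, hK3⟩ := ((ht.eventually_ge_atTop M).and
    ((eventually_ge_atTop R).and (eventually_ge_atTop 0))).exists
  have e1 := (hgrowth K).1
  have e2 := (hgrowth (-K)).1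
  rw [abs_neg] at e2
  rw [abs_of_nonneg hK3] at e1 e2
  exact ⟨K, hK2, hK1.trans e1, hK1.trans e2⟩

lemma ClassG0.nonneg (h : G ∈ ClassG0) (p : ℝ) : 0 ≤ G p := by
  rcases eq_or_ne p 0 with rfl | hp
  · exact h.2.1.ge
  · exact (h.2.2.1 p hp).le

lemma ClassG0.sInf_range (h : G ∈ ClassG0) : sInf (range G) = 0 :=
  IsLeast.csInf_eq ⟨⟨0, h.2.1⟩, by rintro _ ⟨p, rfl⟩; exact ClassG0.nonneg h p⟩

end

end ViscousHJ

theorem theorem3 {Ω : Type*} [MeasurableSpace Ω] (P : Measure Ω) [IsProbabilityMeasure P]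
    (τ : ℝ → Ω → Ω) (hτ : ViscousHJ.IsErgodicFlow P τ)
    (a V : ℝ → Ω → ℝ)
    (ha : ViscousHJ.IsStationaryProcess τ a) (hV : ViscousHJ.IsStationaryProcess τ V)
    (ha_range : ∀ x ω, 0 < a x ω ∧ a x ω ≤ 1)
    (hV_range : ∀ x ω, 0 ≤ V x ω ∧ V x ω ≤ 1)
    (κ : ℝ≥0) (hκ : 0 < κ)
    (hA : ∀ ω, LipschitzWith κ (fun x => Real.sqrt (a x ω)))
    (hVLip : ∀ ω, LipschitzWith κ (fun x => V x ω))
    (hhill : ViscousHJ.ScaledHill P a V) (hvalley : ViscousHJ.ScaledValley P a V)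
    (β : ℝ) (hβ : 0 < β) :
    ViscousHJ.ClassG0 ⊆ ViscousHJ.ClassG1 P τ a V β := by
  intro G hG
  have hM : ViscousHJ.IsMedium τ a V := ⟨ha, hV, fun ω =>
    { cont_a := by
        exact ((hA ω).continuous.pow 2).congr fun x => Real.sq_sqrt (ha_range x ω).1.le
      pos := fun x => (ha_range x ω).1
      le_one := fun x => (ha_range x ω).2
      cont_v := (hVLip ω).continuous
      v_nonneg := fun x => (hV_range x ω).1
      v_le_one := fun x => (hV_range x ω).2 }⟩
  have hLip := ViscousHJ.ClassG.lipOnBounded hG.1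
  refine ⟨hG.1, fun θ => ?_⟩
  rw [ViscousHJ.ClassG0.sInf_range hG, zero_add]
  obtain ⟨lam, hlam, f₁, f₂, hf⟩ := ViscousHJ.exists_correctorPair hτ hM hLip
    (ViscousHJ.ClassG.isCoercive hG.1) hβ (ViscousHJ.ClassG0.nonneg hG) hG.2.2.2.2 hhill hvalley θ
  refine ⟨lam, ⟨hlam, f₁, f₂, hf⟩, ?_⟩
  rintro lam' ⟨-, g₁, g₂, hg⟩
  exact hg.level_unique hτ hM hLip hf
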